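/- Let $d\ge 0$ and let $(Y_0,Y_1,\dots,Y_d)$ be a Gaussian random vector with positive definite covariance matrix and correlations $\rho_{k,l}=\mathrm{corr}(Y_k,Y_l)$. Write $\rho_{0,k}=\rho_{k,0}$ and suppose $\rho_{0,k}>0$ for $k=1,\dots,d$. Let $V_i=-\log\{1-F_i(Y_i)\}$ with $F_i$ the distribution function of $Y_i$ ($0\le i\le d$), so that $(V_0,\dots,V_d)$ has unit exponential margins and Gaussian copula. Put $$a_k(v)=\rho_{0,k}^2\,v,\qquad b_k(v)=1+\rho_{0,k}\,v^{1/2},\qquad 1\le k\le d,\ v>0,$$ $$\Sigma_0=(\rho_{k,l}-\rho_{k,0}\rho_{l,0})_{1\le k,l\le d},\qquad G(z)=\Phi_d(z;2\Sigma_0)=\Phi_d(z/\sqrt2;\Sigma_0),$$ where $\Phi_d(\cdot;S)$ is the distribution function of the centred $d$-variate Gaussian law with covariance matrix $S$. For $v>0$ and $z\in\mathbb R^d$ let $$F_v(z)=\mathbb P\left(\frac{V_k-a_k(v)}{b_k(v)}\le z_k,\ k=1,\dots,d\ \Big|\ V_0=v\right),$$ where the conditional law given $V_0=v$ is the (existing)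 version of the regular conditional distribution of $(V_1,\dots,V_d)$ given $V_0$ that is weakly continuous in $v\in(0,\infty)$. Then $G$ is $C^\infty$; for every $z$, $F_v$ is $C^\infty$ in a neighbourhood of $z$ for all sufficiently large $v$; and as $v\to\infty$: (i) for all $r\in\{0,\dots,d\}$ and all distinct indices $k_1,\dots,k_r$, $$\frac{\partial^r}{\partial z_{k_1}\cdots\partial z_{k_r}}F_v(z)\ \to\ \frac{\partial^r}{\partial z_{k_1}\cdots\partial z_{k_r}}G(z)=2^{-r/2}\,\Phi_d^{(k_1,\dots,k_r)}(z/\sqrt2;\Sigma_0);$$ (ii) for every $k$, $$\frac{\partial^2}{\partial z_k^2}F_v(z)\ \to\ \frac{\partial^2}{\partial z_k^2}G(z)=\tfrac12\,\Phi_d^{(kk)}(z/\sqrt2;\Sigma_0).$$ Here $\Phi_d^{(k_1,\dots,k_r)}$ denotes the partial derivative of $\Phi_d(\cdot;\Sigma_0)$ with respect to the coordinates $k_1,\dots,k_r$. In particular $F_v\to G$ together with all first and second order partial derivatives. Moreover $V_0,\dots,V_d$ are unit exponential, $a_k$ and $b_k$ are twice continuously differentiable on $(0,\infty)$, and $a_k'(v)\to\rho_{0,k}^2$,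 $a_k''(v)\to0$, $b_k'(v)/b_k(v)\to0$ as $v\to\infty$. -/

import Mathlib

open MeasureTheory ProbabilityTheory Filter Topology
open scoped BoundedContinuousFunction

noncomputable section

namespace GaussCopula

variable {Ω : Type*} [MeasurableSpace Ω]

/-- The Pearson correlation of two real random variables. -/
def corr (P : Measure Ω) (X Y : Ω → ℝ) : ℝ :=
  cov[X, Y; P] / (√(Var[X; P]) * √(Var[Y; P]))

/-- The marginal transformation of `X` to the unit exponential scale, `-log (1 - F_X(X))`.
For a standard normal `X` this is `T(X)` with `T(y) = -log (1 - Φ(y))`. -/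
def toExp (P : Measure Ω) (X : Ω → ℝ) (ω : Ω) : ℝ :=
  -Real.log (1 - cdf (P.map X) (X ω))

/-- `κ v` is the conditional law of `Y` given `X = v`: `κ` is a regular conditional distribution of
`Y` given `X`, and it is the version that is weakly continuous in the conditioning value
`v ∈ (0, ∞)`. (A regular conditional distribution is determined only up to null sets of `v`; when
the law of `X` has a positive density on `(0, ∞)`, weak continuity fixes it at every `v > 0`.) -/
structure IsContCondDistrib {E : Type*} [TopologicalSpace E] [MeasurableSpace E]
    (P : Measure Ω) (X : Ω → ℝ) (Y : Ω → E) (κ : Kernel ℝ E) : Prop where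
  markov : IsMarkovKernel κ
  disintegrate : (P.map X) ⊗ₘ κ = P.map (fun ω => (X ω, Y ω))
  continuousOn : ∀ f : E →ᵇ ℝ, ContinuousOn (fun v => ∫ x, f x ∂(κ v)) (Set.Ioi 0)

variable {d : ℕ}

/-- The location normalisation `a_k(v) = ρ_{0,k}² v`. -/
def loc (ρ₀ : Fin d → ℝ) (k : Fin d) (v : ℝ) : ℝ := ρ₀ k ^ 2 * v

/-- The scale normalisation `b_k(v) = 1 + ρ_{0,k} v^{1/2} = 1 + a_k(v)^{1/2}`. -/
def scale (ρ₀ : Fin d → ℝ) (k : Fin d) (v : ℝ) : ℝ := 1 + ρ₀ k * √v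

/-- The normalised conditional distribution function
`z ↦ ℙ((V - a(v)) / b(v) ≤ z | V₀ = v)`, where `κ v` is the conditional law of `V`
given `V₀ = v`. -/
def normCondCDF (κ : Kernel ℝ (Fin d → ℝ)) (a b : Fin d → ℝ → ℝ) (v : ℝ) (z : Fin d → ℝ) : ℝ :=
  (κ v).real {x | ∀ k, (x k - a k v) / b k v ≤ z k}

/-- `Φ_d(·; S)`, the distribution function of the centred `d`-variate Gaussian law with
covariance matrix `S`. -/
def gaussCDF (S : Matrix (Fin d) (Fin d) ℝ) (z : Fin d → ℝ) : ℝ :=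
  (multivariateGaussian 0 S).real {x | ∀ k, x k ≤ z k}

/-- The partial derivative `∂f/∂z_k`. -/
def partialDeriv (k : Fin d) (f : (Fin d → ℝ) → ℝ) (z : Fin d → ℝ) : ℝ :=
  deriv (fun t => f (Function.update z k t)) (z k)

/-- The iterated partial derivative `∂^r f / ∂z_{k₁} ⋯ ∂z_{k_r}` for `l = [k₁, …, k_r]`. -/
def iterPartial (l : List (Fin d)) (f : (Fin d → ℝ) → ℝ) : (Fin d → ℝ) → ℝ :=
  l.foldr partialDeriv f

/-- The correlations `ρ_{0,k}` of `Y_k` with `Y_0`, where `Y_1, …, Y_d` are `Y k.succ`. -/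
def rhoZero (P : Measure Ω) (Y : Fin (d + 1) → Ω → ℝ) (k : Fin d) : ℝ :=
  corr P (Y k.succ) (Y 0)

/-- The matrix `Σ₀ = (ρ_{k,l} - ρ_{k,0} ρ_{l,0})_{1 ≤ k, l ≤ d}`. -/
def sigmaZero (P : Measure Ω) (Y : Fin (d + 1) → Ω → ℝ) : Matrix (Fin d) (Fin d) ℝ :=
  Matrix.of fun k l => corr P (Y k.succ) (Y l.succ) - rhoZero P Y k * rhoZero P Y l

end GaussCopula

end

namespace GaussCopula

/-! Write `T = -log (1 - Φ)` for `normToExp`, `S` for its inverse `expToNorm` on `(0, ∞)`, and let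
`U_i` be the standardised `Y_i`. Regression gives `U_k = ρ_{0,k} U_0 + Z_k`, where `Z` is
independent of `U_0` and has law `N(0, Σ₀)`. Since `V_i = T(U_i)`, conditioning on `V_0 = v` fixes
`U_0 = S(v)`. As soon as all `a_k(v) + b_k(v) z_k` are positive, this yields the exact formula
`F_v(z) = Φ_d(τ(z); Σ₀)`, with `τ_k(z_k) = S(a_k(v) + b_k(v) z_k) - ρ_{0,k} S(v)`
(`normCondCDF_residualKernel`, `IsContCondDistrib.eq_of_pos`).

The substitution `τ` acts on each coordinate separately, so the theorem reduces to the smoothness of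
`Φ_d` (`contDiff_gaussCDF`) and to three scalar limits: `τ_k → z_k/√2`, `τ_k' → 1/√2`, `τ_k'' → 0`.
They follow from `S(x) = √(2x) + o(1)`, `√x S'(x) → 1/√2` and `x S''(x) → 0`. These in turn rest on
one fact about the normal hazard rate `h = T'`, namely `h(y) - y → 0` (`tendsto_hazard_sub_id`),
because `S' = 1/h(S)` and `h' = h (h - y)`. -/

/-- Smooth functions all of whose iterated derivatives are bounded. -/
structure BoundedDerivs {E F : Type*} [NormedAddCommGroup E] [NormedSpace ℝ E]
    [NormedAddCommGroup F] [NormedSpace ℝ F] (f : E → F) : Prop where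
  contDiff : ContDiff ℝ (⊤ : ℕ∞) f
  bounded : ∀ n : ℕ, ∃ C, ∀ x, ‖iteratedFDeriv ℝ n f x‖ ≤ C

/-! ### Functions with bounded derivatives, and averages of their translates -/

namespace BoundedDerivs

section

variable {E E' F : Type*} [NormedAddCommGroup E] [NormedSpace ℝ E]
  [NormedAddCommGroup E'] [NormedSpace ℝ E'] [NormedAddCommGroup F] [NormedSpace ℝ F]

lemma fderiv {f : E → F} (hf : BoundedDerivs f) : BoundedDerivs (_root_.fderiv ℝ f) where
  contDiff := hf.contDiff.fderiv_right (by simp)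
  bounded n := by
    obtain ⟨C, hC⟩ := hf.bounded (n + 1)
    exact ⟨C, fun x => by rw [norm_iteratedFDeriv_fderiv]; exact hC x⟩

lemma const (c : F) : BoundedDerivs (fun _ : E => c) where
  contDiff := contDiff_const
  bounded n := by
    refine ⟨‖c‖, fun x => ?_⟩
    rcases Nat.eq_zero_or_pos n with rfl | hn
    · simp
    · rw [iteratedFDeriv_const_of_ne hn.ne']
      simp

lemma mul {f g : E → ℝ} (hf : BoundedDerivs f) (hg : BoundedDerivs g) :
    BoundedDerivs (fun x => f x * g x) where
  contDiff := hf.contDiff.mul hg.contDiff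
  bounded n := by
    choose A hA using hf.bounded
    choose B hB using hg.bounded
    refine ⟨∑ i ∈ Finset.range (n + 1), (n.choose i : ℝ) * A i * B (n - i), fun x => ?_⟩
    refine (norm_iteratedFDeriv_mul_le hf.contDiff hg.contDiff x
      (by exact_mod_cast le_top)).trans ?_
    gcongr with i _
    · exact mul_nonneg (by positivity) ((norm_nonneg _).trans (hA i x))
    · exact hA i x
    · exact hB (n - i) x

lemma prod {ι : Type*} (s : Finset ι) {f : ι → E → ℝ} (hf : ∀ i, BoundedDerivs (f i)) :
    BoundedDerivs (fun x => ∏ i ∈ s, f i x) := by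
  classical
  induction s using Finset.induction_on with
  | empty => simpa using const (1 : ℝ)
  | insert i s hi ih =>
    simp_rw [Finset.prod_insert hi]
    exact (hf i).mul ih

lemma comp_clm {f : E → F} (hf : BoundedDerivs f) (L : E' →L[ℝ] E) :
    BoundedDerivs (fun x => f (L x)) where
  contDiff := hf.contDiff.comp L.contDiff
  bounded n := by
    obtain ⟨C, hC⟩ := hf.bounded n
    refine ⟨C * ∏ _i : Fin n, ‖L‖, fun x => ?_⟩
    have := L.iteratedFDeriv_comp_right hf.contDiff x (i := n) (by exact_mod_cast le_top)
    rw [show (fun x => f (L x)) = f ∘ L from rfl, this]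
    refine (ContinuousMultilinearMap.norm_compContinuousLinearMap_le _ _).trans ?_
    gcongr
    exact hC _

end

/-- Averaging translates of a smooth function with bounded derivatives gives a smooth function. -/
lemma contDiff_integral_sub {E : Type} [NormedAddCommGroup E] [NormedSpace ℝ E]
    [MeasurableSpace E] [BorelSpace E] [SecondCountableTopology E]
    (μ : Measure E) [IsFiniteMeasure μ] (n : ℕ) :
    ∀ {F : Type} [NormedAddCommGroup F] [NormedSpace ℝ F] {f : E → F}, BoundedDerivs f →
      ContDiff ℝ n (fun z => ∫ w, f (z - w) ∂μ) := by
  have key : ∀ {F : Type} [NormedAddCommGroup F] [NormedSpace ℝ F] {f : E → F},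
      BoundedDerivs f → ∀ z, HasFDerivAt (fun z => ∫ w, f (z - w) ∂μ)
        (∫ w, _root_.fderiv ℝ f (z - w) ∂μ) z := by
    intro F _ _ f hf z
    obtain ⟨C₀, hC₀⟩ := hf.bounded 0
    obtain ⟨C, hC⟩ := hf.bounded 1
    have hmeas : ∀ {G : Type} [NormedAddCommGroup G] [NormedSpace ℝ G] {g : E → G} (x : E),
        Continuous g → AEStronglyMeasurable (fun w => g (x - w)) μ := fun x hg =>
      (hg.comp (continuous_const.sub continuous_id)).aestronglyMeasurable
    refine hasFDerivAt_integral_of_dominated_of_fderiv_le (s := Set.univ)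
      (F' := fun x w => _root_.fderiv ℝ f (x - w)) (bound := fun _ => C) univ_mem
      (Eventually.of_forall fun x => hmeas x hf.contDiff.continuous) ?_
      (hmeas z hf.fderiv.contDiff.continuous) ?_ (integrable_const _) ?_
    · refine Integrable.of_bound (hmeas z hf.contDiff.continuous) C₀
        (Eventually.of_forall fun w => ?_)
      simpa using hC₀ (z - w)
    · refine Eventually.of_forall fun w x _ => ?_
      simpa [norm_iteratedFDeriv_one] using hC (x - w)
    · refine Eventually.of_forall fun w x _ => ?_
      have h1 := (hf.contDiff.differentiable (by simp) (x - w)).hasFDerivAt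
      simpa [Function.comp_def] using h1.comp x ((hasFDerivAt_id x).sub_const w)
  -- The codomain varies within the induction, because each step replaces `f` by its derivative,
  -- which takes values in `E →L[ℝ] F`.
  induction n with
  | zero =>
    intro F _ _ f hf
    exact contDiff_zero.2 (continuous_iff_continuousAt.2 fun z => (key hf z).continuousAt)
  | succ n ih =>
    intro F _ _ f hf
    have hfd : _root_.fderiv ℝ (fun z => ∫ w, f (z - w) ∂μ)
        = fun z => ∫ w, _root_.fderiv ℝ f (z - w) ∂μ := funext fun z => (key hf z).fderiv
    rw [Nat.cast_add, Nat.cast_one, contDiff_succ_iff_fderiv, hfd]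
    exact ⟨fun z => (key hf z).differentiableAt, by simp, ih hf.fderiv⟩

end BoundedDerivs

/-! ### The standard normal distribution function -/

/-- The standard normal distribution function. -/
noncomputable def stdCDF (y : ℝ) : ℝ := cdf (gaussianReal 0 1) y

/-- The standard normal density. -/
noncomputable def stdPDF (y : ℝ) : ℝ := gaussianPDFReal 0 1 y

lemma stdPDF_eq (y : ℝ) : stdPDF y = (√(2 * Real.pi))⁻¹ * Real.exp (-(y ^ 2 / 2)) := by
  simp [stdPDF, gaussianPDFReal, neg_div]

lemma stdPDF_pos (y : ℝ) : 0 < stdPDF y := gaussianPDFReal_pos 0 1 y one_ne_zero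

lemma contDiff_stdPDF : ContDiff ℝ (⊤ : ℕ∞) stdPDF := by
  rw [funext stdPDF_eq]
  fun_prop

lemma hasDerivAt_stdPDF (y : ℝ) : HasDerivAt stdPDF (-y * stdPDF y) y := by
  rw [funext stdPDF_eq]
  have h : HasDerivAt (fun y : ℝ => -(y ^ 2 / 2)) (-y) y := by
    convert! ((hasDerivAt_pow 2 y).div_const 2).neg using 1
    push_cast
    ring
  convert! h.exp.const_mul (√(2 * Real.pi))⁻¹ using 1
  ring

lemma stdCDF_eq_integral (y : ℝ) : stdCDF y = ∫ t in Set.Iic y, stdPDF t := by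
  rw [stdCDF, cdf_eq_real, Measure.real, gaussianReal_apply_eq_integral 0 one_ne_zero,
    ENNReal.toReal_ofReal]
  · rfl
  · exact setIntegral_nonneg measurableSet_Iic fun t _ => gaussianPDFReal_nonneg 0 1 t

lemma hasDerivAt_stdCDF (y : ℝ) : HasDerivAt stdCDF (stdPDF y) y := by
  have hint : Integrable stdPDF := integrable_gaussianPDFReal 0 1
  have h : stdCDF = fun y => (∫ t in (0 : ℝ)..y, stdPDF t) + stdCDF 0 := by
    funext y
    rw [stdCDF_eq_integral, stdCDF_eq_integral,
      ← intervalIntegral.integral_Iic_sub_Iic hint.integrableOn hint.integrableOn]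
    ring
  rw [h]
  exact (intervalIntegral.integral_hasDerivAt_right hint.intervalIntegrable
    contDiff_stdPDF.continuous.stronglyMeasurable.stronglyMeasurableAtFilter
    contDiff_stdPDF.continuous.continuousAt).add_const _

lemma contDiff_stdCDF : ContDiff ℝ (⊤ : ℕ∞) stdCDF := by
  rw [contDiff_infty_iff_deriv]
  refine ⟨fun y => (hasDerivAt_stdCDF y).differentiableAt, ?_⟩
  rw [funext fun y => (hasDerivAt_stdCDF y).deriv]
  exact contDiff_stdPDF

lemma strictMono_stdCDF : StrictMono stdCDF :=
  strictMono_of_hasDerivAt_pos hasDerivAt_stdCDF stdPDF_pos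

lemma stdCDF_lt_one (y : ℝ) : stdCDF y < 1 :=
  (strictMono_stdCDF (lt_add_one y)).trans_le (cdf_le_one _ _)

lemma stdCDF_pos (y : ℝ) : 0 < stdCDF y :=
  (cdf_nonneg _ _).trans_lt (strictMono_stdCDF (sub_one_lt y))

/-- For a monomial, combine `|x|^n ≤ n! e^|x|` with `|x| - x²/2 ≤ 1/2`, a rearrangement of `(|x| -
1)² ≥ 0`. -/
lemma exists_bound_polynomial_mul_gaussian (p : Polynomial ℝ) :
    ∃ C, ∀ x : ℝ, |p.eval x * Real.exp (-(x ^ 2 / 2))| ≤ C := by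
  induction p using Polynomial.induction_on' with
  | add p q hp hq =>
    obtain ⟨A, hA⟩ := hp
    obtain ⟨B, hB⟩ := hq
    refine ⟨A + B, fun x => ?_⟩
    rw [Polynomial.eval_add, add_mul]
    exact (abs_add_le _ _).trans (add_le_add (hA x) (hB x))
  | monomial n a =>
    refine ⟨|a| * (n.factorial * Real.exp (1 / 2)), fun x => ?_⟩
    rw [Polynomial.eval_monomial, abs_mul, abs_mul, mul_assoc, abs_pow, abs_of_pos (Real.exp_pos _)]
    refine mul_le_mul_of_nonneg_left ?_ (abs_nonneg a)
    have h1 : |x| ^ n ≤ n.factorial * Real.exp |x| := by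
      have := Real.pow_div_factorial_le_exp |x| (abs_nonneg x) n
      rwa [div_le_iff₀' (by positivity)] at this
    calc |x| ^ n * Real.exp (-(x ^ 2 / 2))
        ≤ n.factorial * Real.exp |x| * Real.exp (-(x ^ 2 / 2)) := by gcongr
      _ = n.factorial * Real.exp (|x| + -(x ^ 2 / 2)) := by rw [mul_assoc, Real.exp_add]
      _ ≤ n.factorial * Real.exp (1 / 2) := by
        gcongr
        nlinarith [sq_abs x, sq_nonneg (|x| - 1)]

/-- Beyond order zero, the derivatives of `Φ` are Hermite polynomials times the Gaussian density, up
to sign. -/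
lemma boundedDerivs_stdCDF : BoundedDerivs stdCDF where
  contDiff := contDiff_stdCDF
  bounded n := by
    cases n with
    | zero =>
      refine ⟨1, fun x => ?_⟩
      rw [norm_iteratedFDeriv_zero, Real.norm_of_nonneg (stdCDF_pos x).le]
      exact (stdCDF_lt_one x).le
    | succ n =>
      obtain ⟨C, hC⟩ := exists_bound_polynomial_mul_gaussian
        ((Polynomial.hermite n).map (Int.castRingHom ℝ))
      refine ⟨|(√(2 * Real.pi))⁻¹| * C, fun x => ?_⟩
      rw [norm_iteratedFDeriv_eq_norm_iteratedDeriv, iteratedDeriv_succ',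
        funext fun y => (hasDerivAt_stdCDF y).deriv, funext stdPDF_eq]
      rw [iteratedDeriv_const_mul_field, iteratedDeriv_eq_iterate,
        Polynomial.deriv_gaussian_eq_hermite_mul_gaussian, Real.norm_eq_abs, abs_mul, mul_assoc,
        abs_mul ((-1) ^ n), abs_pow, abs_neg, abs_one, one_pow, one_mul]
      gcongr
      simpa [Polynomial.aeval_def, Polynomial.eval_map] using hC x

/-! ### Smoothness of the multivariate Gaussian distribution function -/

lemma measurableSet_orthant {d : ℕ} (c : Fin d → ℝ) :
    MeasurableSet {x : EuclideanSpace ℝ (Fin d) | ∀ k, x k ≤ c k} := by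
  simp only [Set.ofPred_forall]
  exact MeasurableSet.iInter fun k => measurableSet_le (by fun_prop) measurable_const

lemma stdGaussian_real_orthant {d : ℕ} (c : Fin d → ℝ) :
    (stdGaussian (EuclideanSpace ℝ (Fin d))).real {x | ∀ k, x k ≤ c k} =
      ∏ k, stdCDF (c k) := by
  rw [← map_pi_eq_stdGaussian, map_measureReal_apply (by fun_prop) (measurableSet_orthant c)]
  have : (WithLp.toLp 2) ⁻¹' {x : EuclideanSpace ℝ (Fin d) | ∀ k, x k ≤ c k}
      = Set.univ.pi fun k => Set.Iic (c k) := by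
    ext x; simp [Pi.le_def]
  rw [this, measureReal_def, Measure.pi_pi, ENNReal.toReal_prod]
  simp [stdCDF, cdf_eq_real, measureReal_def]

open scoped MatrixOrder in
lemma exists_pos_posSemidef_sub {d : ℕ} {S : Matrix (Fin d) (Fin d) ℝ} (hS : S.PosDef) :
    ∃ ε : ℝ, 0 < ε ∧ (S - ε • (1 : Matrix (Fin d) (Fin d) ℝ)).PosSemidef := by
  -- For `d = 0` the matrix algebra is trivial and any `ε` works. Otherwise `ε` is a positive lower
  -- bound of the spectrum.
  cases subsingleton_or_nontrivial (Matrix (Fin d) (Fin d) ℝ) with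
  | inl h =>
    refine ⟨1, one_pos, ?_⟩
    rw [Subsingleton.elim (S - _) S]
    exact hS.posSemidef
  | inr h =>
    obtain ⟨ε, hε, hle⟩ := (CFC.exists_pos_algebraMap_le_iff hS.isHermitian.isSelfAdjoint).2
      fun x hx => hS.isStrictlyPositive.spectrum_pos hx
    refine ⟨ε, hε, ?_⟩
    rwa [Algebra.algebraMap_eq_smul_one, Matrix.le_iff] at hle

/-- Compare characteristic functions: the quadratic form of `S` is that of `S - ε I` plus `ε ‖t‖²`.
-/
lemma multivariateGaussian_eq_conv {d : ℕ} {S : Matrix (Fin d) (Fin d) ℝ} (hS : S.PosSemidef)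
    {ε : ℝ} (hε : 0 < ε) (hSε : (S - ε • (1 : Matrix (Fin d) (Fin d) ℝ)).PosSemidef) :
    multivariateGaussian 0 S = (multivariateGaussian 0 (S - ε • 1)).conv
      ((stdGaussian (EuclideanSpace ℝ (Fin d))).map (√ε • ·)) := by
  have : IsProbabilityMeasure ((stdGaussian (EuclideanSpace ℝ (Fin d))).map (√ε • ·)) :=
    Measure.isProbabilityMeasure_map (by fun_prop)
  apply Measure.ext_of_charFun
  ext t
  rw [charFun_conv, charFun_multivariateGaussian hS, charFun_multivariateGaussian hSε,
    charFun_map_smul, charFun_stdGaussian, ← Complex.exp_add]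
  congr 1
  have h : t.ofLp ⬝ᵥ t.ofLp = ‖t‖ ^ 2 := by
    rw [EuclideanSpace.real_norm_sq_eq, dotProduct]
    simp [sq]
  rw [norm_smul, Real.norm_of_nonneg (Real.sqrt_nonneg _)]
  simp only [Matrix.sub_mulVec, dotProduct_sub, Matrix.smul_mulVec, Matrix.one_mulVec,
    dotProduct_smul, h, smul_eq_mul]
  push_cast
  rw [mul_pow, ← Complex.ofReal_pow √ε, Real.sq_sqrt hε.le]
  ring

/-- Given the first summand of the convolution, the second has independent coordinates of variance
`ε`, so the orthant probability is a product of one-dimensional ones. -/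
lemma gaussCDF_eq_integral {d : ℕ} {S : Matrix (Fin d) (Fin d) ℝ} (hS : S.PosSemidef)
    {ε : ℝ} (hε : 0 < ε) (hSε : (S - ε • (1 : Matrix (Fin d) (Fin d) ℝ)).PosSemidef)
    (z : Fin d → ℝ) :
    gaussCDF S z = ∫ w, ∏ k, stdCDF ((z - w) k / √ε)
      ∂((multivariateGaussian 0 (S - ε • 1)).map WithLp.ofLp) := by
  have hprob : IsProbabilityMeasure ((stdGaussian (EuclideanSpace ℝ (Fin d))).map (√ε • ·)) :=
    Measure.isProbabilityMeasure_map (by fun_prop)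
  have hs : 0 < √ε := Real.sqrt_pos.2 hε
  rw [gaussCDF, multivariateGaussian_eq_conv hS hε hSε, Measure.conv,
    map_measureReal_apply (by fun_prop) (measurableSet_orthant z), measureReal_def,
    Measure.prod_apply ((by fun_prop : Measurable _) (measurableSet_orthant z)),
    ← integral_toReal]
  rotate_left
  · exact (measurable_measure_prodMk_left
      ((by fun_prop : Measurable _) (measurableSet_orthant z))).aemeasurable
  · exact Eventually.of_forall fun x => measure_lt_top _ _
  rw [integral_map (by fun_prop)]
  · refine integral_congr_ae (Eventually.of_forall fun w => ?_)
    simp only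
    have : Prod.mk w ⁻¹' ((fun x : EuclideanSpace ℝ (Fin d) × EuclideanSpace ℝ (Fin d) =>
        x.1 + x.2) ⁻¹' {x | ∀ k, x k ≤ z k}) = {x | ∀ k, x k ≤ z k - w k} := by
      ext x
      simp [le_sub_iff_add_le']
    rw [this, ← measureReal_def, map_measureReal_apply (by fun_prop) (measurableSet_orthant _)]
    rw [← stdGaussian_real_orthant]
    congr 1
    ext x
    simp [le_div_iff₀ hs, mul_comm]
  · refine Continuous.aestronglyMeasurable ?_
    have := contDiff_stdCDF.continuous
    fun_prop

/-- The Gaussian law of covariance `S - ε I` may be degenerate. All the smoothness comes from the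
averaged product of scalar distribution functions. -/
lemma contDiff_gaussCDF {d : ℕ} {S : Matrix (Fin d) (Fin d) ℝ} (hS : S.PosDef) :
    ContDiff ℝ (⊤ : ℕ∞) (gaussCDF S) := by
  obtain ⟨ε, hε, hSε⟩ := exists_pos_posSemidef_sub hS
  rw [funext (gaussCDF_eq_integral hS.posSemidef hε hSε)]
  have : IsProbabilityMeasure ((multivariateGaussian 0 (S - ε • 1)).map WithLp.ofLp) :=
    Measure.isProbabilityMeasure_map (by fun_prop)
  have hb : BoundedDerivs (fun z : Fin d → ℝ => ∏ k, stdCDF (z k / √ε)) := by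
    refine BoundedDerivs.prod _ fun k => ?_
    have := boundedDerivs_stdCDF.comp_clm
      ((√ε)⁻¹ • (ContinuousLinearMap.proj k : (Fin d → ℝ) →L[ℝ] ℝ))
    simpa [div_eq_inv_mul] using this
  exact contDiff_infty.2 fun n => BoundedDerivs.contDiff_integral_sub _ n hb

/-! ### The hazard rate of the standard normal law -/

lemma one_sub_stdCDF_pos (y : ℝ) : 0 < 1 - stdCDF y := sub_pos.2 (stdCDF_lt_one y)

/-- The hazard rate of the standard normal law. -/
noncomputable def hazard (y : ℝ) : ℝ := stdPDF y / (1 - stdCDF y)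

lemma hazard_pos (y : ℝ) : 0 < hazard y := div_pos (stdPDF_pos y) (one_sub_stdCDF_pos y)

lemma contDiff_hazard : ContDiff ℝ (⊤ : ℕ∞) hazard :=
  contDiff_stdPDF.div (contDiff_const.sub contDiff_stdCDF) fun y => (one_sub_stdCDF_pos y).ne'

lemma hasDerivAt_hazard (y : ℝ) : HasDerivAt hazard (hazard y * (hazard y - y)) y := by
  have h := (hasDerivAt_stdPDF y).div ((hasDerivAt_stdCDF y).const_sub 1)
    (one_sub_stdCDF_pos y).ne'
  convert! h using 1
  have := (one_sub_stdCDF_pos y).ne'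
  rw [hazard]
  field_simp
  ring

lemma tendsto_stdPDF_atTop : Tendsto stdPDF atTop (𝓝 0) := by
  rw [funext stdPDF_eq]
  have h : Tendsto (fun y : ℝ => Real.exp (-(y ^ 2 / 2))) atTop (𝓝 0) :=
    Real.tendsto_exp_neg_atTop_nhds_zero.comp
      ((tendsto_pow_atTop two_ne_zero).atTop_div_const two_pos)
  simpa using h.const_mul (√(2 * Real.pi))⁻¹

lemma tendsto_one_sub_stdCDF_atTop : Tendsto (fun y => 1 - stdCDF y) atTop (𝓝 0) := by
  have h : Tendsto stdCDF atTop (𝓝 1) := tendsto_cdf_atTop _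
  simpa using h.const_sub 1

lemma nonneg_of_deriv_nonpos_of_tendsto_zero {f f' : ℝ → ℝ}
    (hf : ∀ y, 0 < y → HasDerivAt f (f' y) y) (hf' : ∀ y, 0 < y → f' y ≤ 0)
    (hlim : Tendsto f atTop (𝓝 0)) {y : ℝ} (hy : 0 < y) : 0 ≤ f y := by
  have hanti : AntitoneOn f (Set.Ioi 0) := by
    refine antitoneOn_of_deriv_nonpos (convex_Ioi 0)
      (fun x hx => (hf x hx).continuousAt.continuousWithinAt) ?_ ?_
    · rw [interior_Ioi]
      exact fun x hx => (hf x hx).differentiableAt.differentiableWithinAt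
    · rw [interior_Ioi]
      intro x hx
      rw [(hf x hx).deriv]
      exact hf' x hx
  refine le_of_tendsto hlim ?_
  filter_upwards [eventually_ge_atTop y] with x hx
  exact hanti hy (hy.trans_le hx) hx

/-- The lower Mills bound: `φ(y)/y - (1 - Φ(y))` has derivative `-φ(y)/y²` and vanishes at infinity.
-/
lemma le_hazard {y : ℝ} (hy : 0 < y) : y ≤ hazard y := by
  have h := nonneg_of_deriv_nonpos_of_tendsto_zero
    (f := fun y => stdPDF y / y - (1 - stdCDF y)) (f' := fun y => -(stdPDF y / y ^ 2))
    (fun x hx => ?_) (fun x hx => ?_) ?_ hy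
  · rw [hazard, le_div_iff₀ (one_sub_stdCDF_pos y)]
    rwa [sub_nonneg, le_div_iff₀ hy, mul_comm] at h
  · convert! ((hasDerivAt_stdPDF x).div (hasDerivAt_id x) hx.ne').sub
      ((hasDerivAt_stdCDF x).const_sub 1) using 1
    simp only [id]
    field_simp
    ring
  · have := stdPDF_pos x
    simp only [Left.neg_nonpos_iff]
    positivity
  · simpa [div_eq_mul_inv] using
      (tendsto_stdPDF_atTop.mul tendsto_inv_atTop_zero).sub tendsto_one_sub_stdCDF_atTop

/-- The upper bound is obtained in the same way from `(1 - Φ(y)) - φ(y) y/(1 + y²)`, whose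
derivative is `-2φ(y)/(1 + y²)²`. -/
lemma hazard_le {y : ℝ} (hy : 0 < y) : hazard y ≤ y + y⁻¹ := by
  have h := nonneg_of_deriv_nonpos_of_tendsto_zero
    (f := fun y => (1 - stdCDF y) - stdPDF y * (y / (1 + y ^ 2)))
    (f' := fun y => -(2 * stdPDF y / (1 + y ^ 2) ^ 2))
    (fun x hx => ?_) (fun x hx => ?_) ?_ hy
  · rw [hazard, div_le_iff₀ (one_sub_stdCDF_pos y)]
    rw [sub_nonneg, ← mul_div_assoc, div_le_iff₀ (by positivity)] at h
    have : (y + y⁻¹) * (1 - stdCDF y) = (1 - stdCDF y) * (1 + y ^ 2) / y := by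
      field_simp
      ring
    rw [this, le_div_iff₀ hy]
    exact h
  · have h1 : HasDerivAt (fun y : ℝ => 1 + y ^ 2) (2 * x) x := by
      simpa using (hasDerivAt_pow 2 x).const_add 1
    have h2 : (1 + x ^ 2) ≠ 0 := by positivity
    convert! ((hasDerivAt_stdCDF x).const_sub 1).sub
      ((hasDerivAt_stdPDF x).mul ((hasDerivAt_id x).div h1 h2)) using 1
    simp only [id, Pi.div_apply]
    field_simp
    ring
  · have := stdPDF_pos x
    simp only [Left.neg_nonpos_iff]
    positivity
  · have hz : Tendsto (fun y => stdPDF y * (y / (1 + y ^ 2))) atTop (𝓝 0) := by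
      refine tendsto_of_tendsto_of_tendsto_of_le_of_le' tendsto_const_nhds tendsto_stdPDF_atTop
        ?_ ?_
      · filter_upwards [eventually_ge_atTop 0] with x hx
        have := stdPDF_pos x
        positivity
      · filter_upwards [eventually_ge_atTop 0] with x hx
        refine mul_le_of_le_one_right (stdPDF_pos x).le ?_
        rw [div_le_one (by positivity)]
        nlinarith [sq_nonneg (x - 1)]
    simpa using tendsto_one_sub_stdCDF_atTop.sub hz

/-- The weaker `h(y)/y → 1` would not suffice: the limit of `x S''(x)` carries the factor `h - y`
itself. -/
lemma tendsto_hazard_sub_id : Tendsto (fun y => hazard y - y) atTop (𝓝 0) := by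
  refine tendsto_of_tendsto_of_tendsto_of_le_of_le' tendsto_const_nhds
    tendsto_inv_atTop_zero ?_ ?_
  · filter_upwards [eventually_gt_atTop 0] with y hy using sub_nonneg.2 (le_hazard hy)
  · filter_upwards [eventually_gt_atTop 0] with y hy
    linarith [hazard_le hy]

lemma tendsto_hazard_atTop : Tendsto hazard atTop atTop :=
  tendsto_atTop_mono' _ ((eventually_gt_atTop 0).mono fun _ hy => le_hazard hy) tendsto_id

lemma tendsto_id_div_hazard : Tendsto (fun y => y / hazard y) atTop (𝓝 1) := by
  have h := (tendsto_hazard_sub_id.div_atTop tendsto_hazard_atTop).const_sub 1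
  simp only [sub_zero] at h
  refine h.congr fun y => ?_
  have := (hazard_pos y).ne'
  field_simp
  ring

/-! ### The transformation from the standard normal to the unit exponential scale -/

/-- The map carrying the standard normal to the unit exponential law. -/
noncomputable def normToExp (y : ℝ) : ℝ := -Real.log (1 - stdCDF y)

lemma hasDerivAt_normToExp (y : ℝ) : HasDerivAt normToExp (hazard y) y := by
  convert! (((hasDerivAt_stdCDF y).const_sub 1).log (one_sub_stdCDF_pos y).ne').neg using 1
  rw [hazard]
  ring

lemma continuous_normToExp : Continuous normToExp :=
  continuous_iff_continuousAt.2 fun y => (hasDerivAt_normToExp y).continuousAt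

lemma strictMono_normToExp : StrictMono normToExp :=
  strictMono_of_hasDerivAt_pos hasDerivAt_normToExp hazard_pos

lemma normToExp_pos (y : ℝ) : 0 < normToExp y :=
  neg_pos.2 (Real.log_neg (one_sub_stdCDF_pos y) (by linarith [stdCDF_pos y]))

lemma stdCDF_eq_one_sub_exp (y : ℝ) : stdCDF y = 1 - Real.exp (-normToExp y) := by
  rw [normToExp, neg_neg, Real.exp_log (one_sub_stdCDF_pos y)]
  ring

lemma exists_normToExp_eq {x : ℝ} (hx : 0 < x) : ∃ y, normToExp y = x := by
  have h0 : ∃ y, normToExp y < x := by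
    have h : Tendsto normToExp atBot (𝓝 0) := by
      have h1 : Tendsto stdCDF atBot (𝓝 0) := tendsto_cdf_atBot _
      have h2 := ((h1.const_sub 1).log (by simp)).neg
      simpa [normToExp] using! h2
    exact (h.eventually_lt_const hx).exists
  have h1 : ∃ y, x < normToExp y := by
    have h : Tendsto (fun y => Real.log (1 - stdCDF y)) atTop atBot :=
      Real.tendsto_log_nhdsGT_zero.comp
        (tendsto_nhdsWithin_iff.2 ⟨tendsto_one_sub_stdCDF_atTop,
          Eventually.of_forall one_sub_stdCDF_pos⟩)
    exact ((tendsto_neg_atBot_atTop.comp h).eventually_gt_atTop x).exists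
  obtain ⟨y₀, h0⟩ := h0
  obtain ⟨y₁, h1⟩ := h1
  exact mem_range_of_exists_le_of_exists_ge continuous_normToExp ⟨y₀, h0.le⟩ ⟨y₁, h1.le⟩

/-- As `1 - Φ = φ/h`, the difference `2T(y) - y²` is a constant plus `2 log h(y)`, hence `o(y)`.
Division by `√(2T(y)) + y ≥ y` concludes. -/
lemma tendsto_sqrt_two_mul_normToExp_sub_id :
    Tendsto (fun y => √(2 * normToExp y) - y) atTop (𝓝 0) := by
  have hT : ∀ y, 2 * normToExp y - y ^ 2
      = 2 * Real.log √(2 * Real.pi) + 2 * Real.log (hazard y) := by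
    intro y
    have h1 : hazard y = stdPDF y / (1 - stdCDF y) := rfl
    have hpi : (√(2 * Real.pi))⁻¹ ≠ 0 := by positivity
    rw [h1, Real.log_div (stdPDF_pos y).ne' (one_sub_stdCDF_pos y).ne', stdPDF_eq,
      Real.log_mul hpi (Real.exp_pos _).ne', Real.log_exp, Real.log_inv, normToExp]
    ring
  have hlog : Tendsto (fun y => (2 * Real.log √(2 * Real.pi) + 2 * Real.log (hazard y)) / y)
      atTop (𝓝 0) := by
    have h1 : Tendsto (fun y => Real.log (hazard y) / y) atTop (𝓝 0) := by
      have h2 : Tendsto (fun x => Real.log x / x) atTop (𝓝 0) :=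
        Real.isLittleO_log_id_atTop.tendsto_div_nhds_zero
      have h3 := (h2.comp tendsto_hazard_atTop).mul (tendsto_id_div_hazard.inv₀ one_ne_zero)
      simp only [zero_mul] at h3
      refine h3.congr' ?_
      filter_upwards [eventually_gt_atTop 0] with y hy
      have := (hazard_pos y).ne'
      simp only [Function.comp_apply]
      field_simp
    have h4 := (tendsto_inv_atTop_zero.const_mul (2 * Real.log √(2 * Real.pi))).add
      (h1.const_mul 2)
    simp only [mul_zero, add_zero] at h4
    refine h4.congr fun y => ?_
    ring
  refine squeeze_zero_norm' ?_ (norm_zero (E := ℝ) ▸ hlog.norm)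
  filter_upwards [eventually_gt_atTop 0] with y hy
  have hT0 : 0 ≤ 2 * normToExp y := by linarith [normToExp_pos y]
  have hpos : 0 < √(2 * normToExp y) + y := add_pos_of_nonneg_of_pos (Real.sqrt_nonneg _) hy
  have h1 : √(2 * normToExp y) - y = (2 * normToExp y - y ^ 2) / (√(2 * normToExp y) + y) := by
    rw [eq_div_iff hpos.ne']
    nlinarith [Real.sq_sqrt hT0]
  rw [h1, hT, norm_div, norm_div, Real.norm_of_nonneg hpos.le, Real.norm_of_nonneg hy.le]
  gcongr
  linarith [Real.sqrt_nonneg (2 * normToExp y)]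

/-! ### The inverse transformation -/

/-- The inverse of `normToExp` on `(0, ∞)`. -/
noncomputable def expToNorm (x : ℝ) : ℝ := Function.invFun normToExp x

lemma normToExp_expToNorm {x : ℝ} (hx : 0 < x) : normToExp (expToNorm x) = x :=
  Function.invFun_eq (exists_normToExp_eq hx)

lemma expToNorm_normToExp (y : ℝ) : expToNorm (normToExp y) = y :=
  Function.leftInverse_invFun strictMono_normToExp.injective y

lemma normToExp_le_iff {x y : ℝ} (hx : 0 < x) : normToExp y ≤ x ↔ y ≤ expToNorm x := by
  conv_lhs => rw [← normToExp_expToNorm hx]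
  exact strictMono_normToExp.le_iff_le

lemma monotoneOn_expToNorm : MonotoneOn expToNorm (Set.Ioi 0) := by
  intro x hx y hy hxy
  rwa [← normToExp_le_iff hy, normToExp_expToNorm hx]

lemma continuousAt_expToNorm {x : ℝ} (hx : 0 < x) : ContinuousAt expToNorm x := by
  refine continuousAt_of_monotoneOn_of_image_mem_nhds monotoneOn_expToNorm (Ioi_mem_nhds hx) ?_
  have : expToNorm '' Set.Ioi 0 = Set.univ :=
    Set.eq_univ_of_forall fun y => ⟨normToExp y, normToExp_pos y, expToNorm_normToExp y⟩
  rw [this]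
  exact univ_mem

lemma measurable_expToNorm : Measurable expToNorm := by
  -- On `(-∞, 0]` there is no preimage, so `Function.invFun` returns one fixed default value and the
  -- function is constant there.
  have h : expToNorm = Set.piecewise (Set.Ioi 0) expToNorm (fun _ => expToNorm 0) := by
    funext x
    by_cases hx : x ∈ Set.Ioi (0 : ℝ)
    · rw [Set.piecewise_eq_of_mem _ _ _ hx]
    · rw [Set.piecewise_eq_of_notMem _ _ _ hx]
      have h1 : ∀ x ≤ 0, ¬ ∃ y, normToExp y = x := by
        rintro x hx ⟨y, rfl⟩
        exact (normToExp_pos y).not_ge hx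
      rw [expToNorm, expToNorm, Function.invFun_neg (h1 x (not_lt.1 hx)),
        Function.invFun_neg (h1 0 le_rfl)]
  rw [h]
  refine measurable_of_restrict_of_restrict_compl (measurableSet_Ioi (a := (0 : ℝ))) ?_ ?_
  · rw [Set.domRestrict_piecewise]
    refine Continuous.measurable ?_
    rw [← continuousOn_iff_continuous_domRestrict]
    exact fun x hx => (continuousAt_expToNorm hx).continuousWithinAt
  · rw [Set.domRestrict_piecewise_compl]
    exact measurable_const

lemma hasDerivAt_expToNorm {x : ℝ} (hx : 0 < x) :
    HasDerivAt expToNorm (hazard (expToNorm x))⁻¹ x := by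
  refine HasDerivAt.of_local_left_inverse (continuousAt_expToNorm hx)
    (hasDerivAt_normToExp _) (hazard_pos _).ne' ?_
  filter_upwards [Ioi_mem_nhds hx] with y hy using normToExp_expToNorm hy

lemma hasDerivAt_deriv_expToNorm {x : ℝ} (hx : 0 < x) :
    HasDerivAt (deriv expToNorm)
      (-((hazard (expToNorm x) - expToNorm x) / hazard (expToNorm x) ^ 2)) x := by
  have h1 : deriv expToNorm =ᶠ[𝓝 x] fun x => (hazard (expToNorm x))⁻¹ := by
    filter_upwards [Ioi_mem_nhds hx] with y hy using (hasDerivAt_expToNorm hy).deriv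
  refine HasDerivAt.congr_of_eventuallyEq ?_ h1
  have h2 := (hasDerivAt_hazard (expToNorm x)).comp x (hasDerivAt_expToNorm hx)
  convert! h2.inv (hazard_pos _).ne' using 1
  have := (hazard_pos (expToNorm x)).ne'
  simp only [Function.comp_apply]
  field_simp

/-- Bootstrap: the derivative is the smooth function `1/h` composed with `expToNorm`, so each order
of regularity yields the next. -/
lemma contDiffOn_expToNorm : ContDiffOn ℝ (⊤ : ℕ∞) expToNorm (Set.Ioi 0) := by
  refine contDiffOn_infty.2 fun n => ?_
  induction n with
  | zero =>
    exact contDiffOn_zero.2 fun x hx => (continuousAt_expToNorm hx).continuousWithinAt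
  | succ n ih =>
    rw [Nat.cast_add, Nat.cast_one, contDiffOn_succ_iff_deriv_of_isOpen isOpen_Ioi]
    refine ⟨fun x hx => (hasDerivAt_expToNorm hx).differentiableAt.differentiableWithinAt,
      by simp, ?_⟩
    have h : ContDiff ℝ n fun y => (hazard y)⁻¹ :=
      (contDiff_hazard.inv fun y => (hazard_pos y).ne').of_le (by exact_mod_cast le_top)
    exact (h.comp_contDiffOn ih).congr fun x hx => (hasDerivAt_expToNorm hx).deriv

lemma tendsto_expToNorm_atTop : Tendsto expToNorm atTop atTop := by
  refine tendsto_atTop.2 fun M => ?_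
  filter_upwards [eventually_ge_atTop (normToExp M)] with x hx
  rw [← expToNorm_normToExp M]
  exact monotoneOn_expToNorm (normToExp_pos M) ((normToExp_pos M).trans_le hx) hx

lemma tendsto_expToNorm_sub_sqrt : Tendsto (fun x => expToNorm x - √(2 * x)) atTop (𝓝 0) := by
  have h := (tendsto_sqrt_two_mul_normToExp_sub_id.comp tendsto_expToNorm_atTop).neg
  rw [neg_zero] at h
  refine h.congr' ?_
  filter_upwards [eventually_gt_atTop 0] with x hx
  simp [normToExp_expToNorm hx]

/-- With `y = S(x)` the quantity equals `√(2T(y)) / (√2 h(y))`, where `√(2T(y)) = y + o(1)` and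
`y/h(y) → 1`. -/
lemma tendsto_sqrt_mul_deriv_expToNorm :
    Tendsto (fun x => √x * deriv expToNorm x) atTop (𝓝 (√2)⁻¹) := by
  have h := ((tendsto_sqrt_two_mul_normToExp_sub_id.div_atTop tendsto_hazard_atTop).add
    tendsto_id_div_hazard).const_mul (√2)⁻¹
  rw [zero_add, mul_one] at h
  refine (h.comp tendsto_expToNorm_atTop).congr' ?_
  filter_upwards [eventually_gt_atTop 0] with x hx
  have := (hazard_pos (expToNorm x)).ne'
  simp only [Function.comp_apply, normToExp_expToNorm hx, (hasDerivAt_expToNorm hx).deriv,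
    Real.sqrt_mul zero_le_two]
  field_simp
  ring

/-- Here `x S''(x) = -(√x S'(x))² (h(y) - y)` with `y = S(x)`: a bounded factor times one that
vanishes. -/
lemma tendsto_mul_deriv_deriv_expToNorm :
    Tendsto (fun x => x * deriv (deriv expToNorm) x) atTop (𝓝 0) := by
  have h := (tendsto_sqrt_mul_deriv_expToNorm.pow 2).mul
    (tendsto_hazard_sub_id.comp tendsto_expToNorm_atTop).neg
  rw [neg_zero, mul_zero] at h
  refine h.congr' ?_
  filter_upwards [eventually_gt_atTop 0] with x hx
  rw [(hasDerivAt_expToNorm hx).deriv, (hasDerivAt_deriv_expToNorm hx).deriv, mul_pow,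
    Real.sq_sqrt hx.le]
  simp only [Function.comp_apply]
  ring

/-! ### The normalised transformation -/

section Normalised

variable {d : ℕ} (ρ₀ : Fin d → ℝ) (k : Fin d) (z : ℝ)

/-- The point `a_k(v) + b_k(v) z` on the exponential scale. -/
noncomputable def affinePoint (v : ℝ) : ℝ := loc ρ₀ k v + scale ρ₀ k v * z

/-- The point `z` of the normalised exponential scale, expressed on the residual normal scale. -/
noncomputable def residualPoint (v : ℝ) : ℝ :=
  expToNorm (affinePoint ρ₀ k z v) - ρ₀ k * expToNorm v

variable {ρ₀ k}

lemma scale_pos (hρ : 0 < ρ₀ k) (v : ℝ) : 0 < scale ρ₀ k v := by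
  unfold scale
  positivity

lemma tendsto_scale_div_sqrt : Tendsto (fun v => scale ρ₀ k v / √v) atTop (𝓝 (ρ₀ k)) := by
  have h := (tendsto_inv_atTop_zero.comp Real.tendsto_sqrt_atTop).add_const (ρ₀ k)
  rw [zero_add] at h
  refine h.congr' ?_
  filter_upwards [eventually_gt_atTop 0] with v hv
  have := (Real.sqrt_pos.2 hv).ne'
  simp only [scale, Function.comp_apply]
  field_simp

lemma tendsto_affinePoint_div : Tendsto (fun v => affinePoint ρ₀ k z v / v) atTop
    (𝓝 (ρ₀ k ^ 2)) := by
  have h := ((tendsto_scale_div_sqrt (ρ₀ := ρ₀) (k := k)).mul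
    (tendsto_inv_atTop_zero.comp Real.tendsto_sqrt_atTop)).mul_const z |>.const_add (ρ₀ k ^ 2)
  simp only [mul_zero, zero_mul, add_zero] at h
  refine h.congr' ?_
  filter_upwards [eventually_gt_atTop 0] with v hv
  have h1 := (Real.sqrt_pos.2 hv).ne'
  have h2 : √v ^ 2 = v := Real.sq_sqrt hv.le
  simp only [affinePoint, loc, Function.comp_apply]
  rw [add_div, mul_div_cancel_right₀ _ hv.ne']
  congr 1
  field_simp
  rw [h2]
  ring

lemma tendsto_affinePoint_atTop (hρ : 0 < ρ₀ k) : Tendsto (affinePoint ρ₀ k z) atTop atTop := by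
  have h := (tendsto_affinePoint_div (ρ₀ := ρ₀) (k := k) z).pos_mul_atTop (by positivity) tendsto_id
  refine h.congr' ?_
  filter_upwards [eventually_gt_atTop 0] with v hv
  simp [div_mul_cancel₀ _ hv.ne']

lemma tendsto_sqrt_affinePoint_div_sqrt (hρ : 0 < ρ₀ k) :
    Tendsto (fun v => √(affinePoint ρ₀ k z v) / √v) atTop (𝓝 (ρ₀ k)) := by
  have h := (tendsto_affinePoint_div (ρ₀ := ρ₀) (k := k) z).sqrt
  rw [Real.sqrt_sq hρ.le] at h
  refine h.congr' ?_
  filter_upwards [eventually_gt_atTop 0] with v hv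
  rw [Real.sqrt_div' _ hv.le]

lemma tendsto_scale_div_sqrt_affinePoint (hρ : 0 < ρ₀ k) :
    Tendsto (fun v => scale ρ₀ k v / √(affinePoint ρ₀ k z v)) atTop (𝓝 1) := by
  have h := (tendsto_scale_div_sqrt (ρ₀ := ρ₀) (k := k)).div
    (tendsto_sqrt_affinePoint_div_sqrt z hρ) hρ.ne'
  rw [div_self hρ.ne'] at h
  refine h.congr' ?_
  filter_upwards [eventually_gt_atTop 0] with v hv
  exact div_div_div_cancel_right₀ (Real.sqrt_pos.2 hv).ne' _ _

lemma tendsto_residualPoint (hρ : 0 < ρ₀ k) :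
    Tendsto (residualPoint ρ₀ k z) atTop (𝓝 (z / √2)) := by
  have h1 := tendsto_expToNorm_sub_sqrt.comp (tendsto_affinePoint_atTop z hρ)
  have h2 := tendsto_expToNorm_sub_sqrt.const_mul (ρ₀ k)
  -- With `A = a + b z`, the conjugate gives `√A - ρ√v = b z / (√A + ρ√v)`. After division by `√v`
  -- the limit is `ρ z / (2ρ)`.
  have h3 : Tendsto (fun v => √2 * (√(affinePoint ρ₀ k z v) - ρ₀ k * √v)) atTop (𝓝 (z / √2)) := by
    have h := ((tendsto_scale_div_sqrt (ρ₀ := ρ₀) (k := k)).mul_const z).div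
      ((tendsto_sqrt_affinePoint_div_sqrt z hρ).add_const (ρ₀ k)) (by positivity) |>.const_mul √2
    have hlim : √2 * (ρ₀ k * z / (ρ₀ k + ρ₀ k)) = z / √2 := by
      have h2 : √2 * √2 = 2 := Real.mul_self_sqrt zero_le_two
      rw [eq_div_iff (by positivity)]
      have := hρ.ne'
      field_simp
      linear_combination z * h2
    rw [hlim] at h
    refine h.congr' ?_
    filter_upwards [eventually_gt_atTop 0,
      (tendsto_affinePoint_atTop z hρ).eventually_gt_atTop 0] with v hv hx
    have hv' := Real.sqrt_pos.2 hv
    have hx' := Real.sqrt_pos.2 hx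
    have e1 := Real.sq_sqrt hv.le
    have e2 := Real.sq_sqrt hx.le
    have e3 : affinePoint ρ₀ k z v = ρ₀ k ^ 2 * v + scale ρ₀ k v * z := rfl
    congr 1
    simp only [Pi.div_apply]
    have hpos : 0 < √(affinePoint ρ₀ k z v) / √v + ρ₀ k := by positivity
    rw [div_eq_iff hpos.ne']
    field_simp
    linear_combination ρ₀ k ^ 2 * e1 - e2 - e3
  have h := (h1.sub h2).add h3
  rw [mul_zero, sub_zero, zero_add] at h
  refine h.congr fun v => ?_
  simp only [residualPoint, Function.comp_apply, Real.sqrt_mul zero_le_two]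
  ring

lemma tendsto_scale_mul_deriv_expToNorm (hρ : 0 < ρ₀ k) :
    Tendsto (fun v => scale ρ₀ k v * deriv expToNorm (affinePoint ρ₀ k z v)) atTop
      (𝓝 (√2)⁻¹) := by
  have h := (tendsto_scale_div_sqrt_affinePoint z hρ).mul
    (tendsto_sqrt_mul_deriv_expToNorm.comp (tendsto_affinePoint_atTop z hρ))
  rw [one_mul] at h
  refine h.congr' ?_
  filter_upwards [(tendsto_affinePoint_atTop z hρ).eventually_gt_atTop 0] with v hx
  have := (Real.sqrt_pos.2 hx).ne'
  simp only [Function.comp_apply]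
  field_simp

lemma tendsto_scale_sq_mul_deriv_deriv_expToNorm (hρ : 0 < ρ₀ k) :
    Tendsto (fun v => scale ρ₀ k v ^ 2 * deriv (deriv expToNorm) (affinePoint ρ₀ k z v)) atTop
      (𝓝 0) := by
  have h := ((tendsto_scale_div_sqrt_affinePoint z hρ).pow 2).mul
    (tendsto_mul_deriv_deriv_expToNorm.comp (tendsto_affinePoint_atTop z hρ))
  rw [mul_zero] at h
  refine h.congr' ?_
  filter_upwards [(tendsto_affinePoint_atTop z hρ).eventually_gt_atTop 0] with v hx
  simp only [Function.comp_apply]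
  rw [div_pow, Real.sq_sqrt hx.le]
  field_simp

end Normalised

/-! ### Iterated partial derivatives -/

section Partial

variable {d : ℕ}

lemma iterPartial_nil (f : (Fin d → ℝ) → ℝ) : iterPartial [] f = f := rfl

lemma iterPartial_cons (k : Fin d) (l : List (Fin d)) (f : (Fin d → ℝ) → ℝ) :
    iterPartial (k :: l) f = partialDeriv k (iterPartial l f) := rfl

lemma partialDeriv_congr {f g : (Fin d → ℝ) → ℝ} {z : Fin d → ℝ} (h : f =ᶠ[𝓝 z] g) (k : Fin d) :
    partialDeriv k f =ᶠ[𝓝 z] partialDeriv k g := by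
  filter_upwards [eventually_eventually_nhds.2 h] with y hy
  refine EventuallyEq.deriv_eq ?_
  have hc : Tendsto (fun t => Function.update y k t) (𝓝 (y k)) (𝓝 y) := by
    have := (continuous_const.update k continuous_id :
      Continuous fun t => Function.update y k t).tendsto (y k)
    rwa [Function.update_eq_self] at this
  exact hc.eventually hy

lemma iterPartial_congr {f g : (Fin d → ℝ) → ℝ} {z : Fin d → ℝ} (h : f =ᶠ[𝓝 z] g)
    (l : List (Fin d)) : iterPartial l f =ᶠ[𝓝 z] iterPartial l g := by
  induction l with
  | nil => exact h
  | cons k l ih => exact partialDeriv_congr ih k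

lemma hasDerivAt_comp_update {f : (Fin d → ℝ) → ℝ} (hf : Differentiable ℝ f) (z : Fin d → ℝ)
    (k : Fin d) (s : ℝ) :
    HasDerivAt (fun t => f (Function.update z k t))
      (fderiv ℝ f (Function.update z k s) (Pi.single k 1)) s :=
  (hf (Function.update z k s)).hasFDerivAt.comp_hasDerivAt s (hasDerivAt_update z k s)

lemma partialDeriv_eq_fderiv {f : (Fin d → ℝ) → ℝ} (hf : Differentiable ℝ f) (k : Fin d)
    (z : Fin d → ℝ) : partialDeriv k f z = fderiv ℝ f z (Pi.single k 1) := by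
  rw [partialDeriv, (hasDerivAt_comp_update hf z k (z k)).deriv, Function.update_eq_self]

lemma hasDerivAt_update_partialDeriv {f : (Fin d → ℝ) → ℝ} (hf : Differentiable ℝ f)
    (z : Fin d → ℝ) (k : Fin d) (s : ℝ) :
    HasDerivAt (fun t => f (Function.update z k t))
      (partialDeriv k f (Function.update z k s)) s := by
  rw [partialDeriv_eq_fderiv hf]
  exact hasDerivAt_comp_update hf z k s

lemma contDiff_partialDeriv {f : (Fin d → ℝ) → ℝ} (hf : ContDiff ℝ (⊤ : ℕ∞) f) (k : Fin d) :
    ContDiff ℝ (⊤ : ℕ∞) (partialDeriv k f) := by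
  rw [funext (partialDeriv_eq_fderiv (hf.differentiable (by simp)) k)]
  exact (hf.fderiv_right (by simp)).clm_apply contDiff_const

lemma contDiff_iterPartial {f : (Fin d → ℝ) → ℝ} (hf : ContDiff ℝ (⊤ : ℕ∞) f)
    (l : List (Fin d)) : ContDiff ℝ (⊤ : ℕ∞) (iterPartial l f) := by
  induction l with
  | nil => exact hf
  | cons k l ih => exact contDiff_partialDeriv ih k

/-- Neither smoothness of `f` nor `c ≠ 0` is needed, because `deriv` obeys the rule for linear
rescaling unconditionally. -/
lemma iterPartial_comp_div (f : (Fin d → ℝ) → ℝ) (c : ℝ) (l : List (Fin d)) (z : Fin d → ℝ) :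
    iterPartial l (fun z => f fun k => z k / c) z =
      iterPartial l f (fun k => z k / c) / c ^ l.length := by
  induction l generalizing z with
  | nil => simp [iterPartial_nil]
  | cons k l ih =>
    rw [iterPartial_cons, iterPartial_cons, funext ih, partialDeriv, deriv_div_const]
    have h : (fun t => iterPartial l f fun j => Function.update z k t j / c) =
        fun t => iterPartial l f (Function.update (fun j => z j / c) k (c⁻¹ * t)) := by
      funext t
      congr 1
      funext j
      rcases eq_or_ne j k with rfl | hj
      · simp [div_eq_inv_mul]
      · simp [hj]
    rw [h, deriv_comp_mul_left c⁻¹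
      (fun s => iterPartial l f (Function.update (fun j => z j / c) k s)), partialDeriv,
      List.length_cons, pow_succ', smul_eq_mul, div_eq_inv_mul (z k)]
    rw [div_mul_eq_div_div, ← div_eq_inv_mul]

section Substitution

variable {f : (Fin d → ℝ) → ℝ} {g g' g'' : Fin d → ℝ → ℝ} {I : Fin d → Set ℝ}

lemma isOpen_forall_mem (hI : ∀ k, IsOpen (I k)) : IsOpen {w : Fin d → ℝ | ∀ k, w k ∈ I k} := by
  have : {w : Fin d → ℝ | ∀ k, w k ∈ I k} = Set.univ.pi I := by
    ext w
    simp
  rw [this]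
  exact isOpen_set_pi Set.finite_univ fun k _ => hI k

lemma comp_update_eq_update_comp (g : Fin d → ℝ → ℝ) (w : Fin d → ℝ) (k : Fin d) (t : ℝ) :
    (fun j => g j (Function.update w k t j)) = Function.update (fun j => g j (w j)) k (g k t) := by
  funext j
  rcases eq_or_ne j k with rfl | hj
  · simp
  · simp [hj]

lemma hasDerivAt_comp_coordinatewise (hf : Differentiable ℝ f) (w : Fin d → ℝ) (k : Fin d)
    (hg : HasDerivAt (g k) (g' k (w k)) (w k)) :
    HasDerivAt (fun t => f fun j => g j (Function.update w k t j))
      (partialDeriv k f (fun j => g j (w j)) * g' k (w k)) (w k) := by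
  simp_rw [comp_update_eq_update_comp]
  have h := hasDerivAt_update_partialDeriv hf (fun j => g j (w j)) k (g k (w k))
  have h2 := h.comp (w k) hg
  rwa [Function.update_eq_self k (fun j => g j (w j))] at h2

/-- Since the indices are distinct, each factor `g' k` is constant in the remaining variables of
differentiation, and no second derivative of `g` appears. -/
lemma iterPartial_comp_coordinatewise (hf : ContDiff ℝ (⊤ : ℕ∞) f) (hI : ∀ k, IsOpen (I k))
    (hg : ∀ k, ∀ t ∈ I k, HasDerivAt (g k) (g' k t) t) {l : List (Fin d)} (hl : l.Nodup)
    {w : Fin d → ℝ} (hw : ∀ k, w k ∈ I k) :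
    iterPartial l (fun w => f fun k => g k (w k)) w =
      iterPartial l f (fun k => g k (w k)) * (l.map fun k => g' k (w k)).prod := by
  induction l generalizing w with
  | nil => simp [iterPartial_nil]
  | cons k l ih =>
    rw [List.nodup_cons] at hl
    have h1 : iterPartial l (fun w => f fun k => g k (w k)) =ᶠ[𝓝 w]
        fun w => iterPartial l f (fun k => g k (w k)) * (l.map fun k => g' k (w k)).prod := by
      filter_upwards [(isOpen_forall_mem hI).mem_nhds hw] with y hy using ih hl.2 hy
    rw [iterPartial_cons, (partialDeriv_congr h1 k).self_of_nhds, partialDeriv]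
    have h2 : ∀ t, (l.map fun j => g' j (Function.update w k t j)) =
        l.map fun j => g' j (w j) := by
      intro t
      refine List.map_congr_left fun j hj => ?_
      rw [Function.update_of_ne (ne_of_mem_of_not_mem hj hl.1)]
    simp_rw [h2]
    have h3 := (hasDerivAt_comp_coordinatewise ((contDiff_iterPartial hf l).differentiable
      (by simp)) w k (hg k (w k) (hw k))).mul_const (l.map fun j => g' j (w j)).prod
    rw [h3.deriv, List.map_cons, List.prod_cons, iterPartial_cons, mul_assoc]

lemma iterPartial_pair_comp_coordinatewise (hf : ContDiff ℝ (⊤ : ℕ∞) f) (hI : ∀ k, IsOpen (I k))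
    (hg : ∀ k, ∀ t ∈ I k, HasDerivAt (g k) (g' k t) t)
    (hg' : ∀ k, ∀ t ∈ I k, HasDerivAt (g' k) (g'' k t) t) (k : Fin d)
    {w : Fin d → ℝ} (hw : ∀ k, w k ∈ I k) :
    iterPartial [k, k] (fun w => f fun k => g k (w k)) w =
      iterPartial [k, k] f (fun k => g k (w k)) * g' k (w k) ^ 2 +
        iterPartial [k] f (fun k => g k (w k)) * g'' k (w k) := by
  have h1 : iterPartial [k] (fun w => f fun k => g k (w k)) =ᶠ[𝓝 w]
      fun w => iterPartial [k] f (fun k => g k (w k)) * g' k (w k) := by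
    filter_upwards [(isOpen_forall_mem hI).mem_nhds hw] with y hy
    simpa using iterPartial_comp_coordinatewise hf hI hg (List.nodup_singleton k) hy
  rw [iterPartial_cons, (partialDeriv_congr h1 k).self_of_nhds, partialDeriv]
  simp_rw [Function.update_self]
  have h2 := (hasDerivAt_comp_coordinatewise ((contDiff_iterPartial hf [k]).differentiable
      (by simp)) w k (hg k (w k) (hw k))).mul (hg' k (w k) (hw k))
  have h3 := h2.deriv
  rw [Function.update_eq_self] at h3
  refine h3.trans ?_
  rw [iterPartial_cons k [k]]
  ring

end Substitution

end Partial

/-! ### The unit exponential law -/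

lemma map_normToExp_gaussianReal : (gaussianReal 0 1).map normToExp = expMeasure 1 := by
  have h1 : IsProbabilityMeasure ((gaussianReal 0 1).map normToExp) :=
    Measure.isProbabilityMeasure_map continuous_normToExp.aemeasurable
  have h2 : IsProbabilityMeasure (expMeasure 1) := isProbabilityMeasure_expMeasure one_pos
  refine Measure.eq_of_cdf _ _ (StieltjesFunction.ext fun x => ?_)
  rw [cdf_expMeasure_eq one_pos, cdf_eq_real,
    map_measureReal_apply continuous_normToExp.measurable measurableSet_Iic]
  by_cases hx : 0 < x
  · have : normToExp ⁻¹' Set.Iic x = Set.Iic (expToNorm x) := by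
      ext y
      simpa using normToExp_le_iff hx
    rw [if_pos hx.le, this, ← cdf_eq_real, one_mul]
    change stdCDF _ = _
    rw [stdCDF_eq_one_sub_exp, normToExp_expToNorm hx]
  · have : normToExp ⁻¹' Set.Iic x = ∅ := by
      ext y
      simpa using (not_lt.1 hx).trans_lt (normToExp_pos y)
    rw [this, measureReal_empty]
    split_ifs with h0
    · rw [le_antisymm (not_lt.1 hx) h0]
      simp
    · rfl

/-- The exponential density is positive on `(0, ∞)`. -/
lemma ae_volume_restrict_of_ae_expMeasure {p : ℝ → Prop} (h : ∀ᵐ x ∂(expMeasure 1), p x) :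
    ∀ᵐ x ∂(volume.restrict (Set.Ioi (0 : ℝ))), p x := by
  have h1 : ∀ᵐ x : ℝ, exponentialPDF 1 x ≠ 0 → p x :=
    (ae_withDensity_iff (measurable_exponentialPDFReal 1).ennreal_ofReal).1 h
  rw [ae_restrict_iff' measurableSet_Ioi]
  filter_upwards [h1] with x hx hx0
  exact hx (ENNReal.ofReal_pos.2 (exponentialPDFReal_pos one_pos hx0)).ne'

/-! ### Continuous conditional distributions -/

section CondDistrib

variable {Ω : Type*} [MeasurableSpace Ω] {P : Measure Ω} {d : ℕ}

/-- Two versions agree for almost every `v > 0`. Continuity of the integrals of bounded continuous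
functions extends this to every `v > 0`. -/
lemma IsContCondDistrib.eq_of_pos {X : Ω → ℝ} {Y : Ω → Fin d → ℝ} {κ η : Kernel ℝ (Fin d → ℝ)}
    (hX : P.map X = expMeasure 1) (hκ : IsContCondDistrib P X Y κ)
    (hη : IsContCondDistrib P X Y η) {v : ℝ} (hv : 0 < v) : κ v = η v := by
  have := hκ.markov
  have := hη.markov
  have := isProbabilityMeasure_expMeasure one_pos
  have hae : κ =ᵐ[expMeasure 1] η := by
    refine Kernel.ae_eq_of_compProd_eq ?_
    rw [← hX, hκ.disintegrate, hη.disintegrate]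
  refine ext_of_forall_integral_eq_of_IsFiniteMeasure fun f => ?_
  have h : (fun v => ∫ x, f x ∂(κ v)) =ᵐ[volume.restrict (Set.Ioi 0)]
      fun v => ∫ x, f x ∂(η v) :=
    ae_volume_restrict_of_ae_expMeasure (hae.mono fun v hv => by simp only [hv])
  exact Measure.eqOn_open_of_ae_eq h isOpen_Ioi (hκ.continuousOn f) (hη.continuousOn f) hv

/-- The point on the exponential scale determined by the conditioning value and the residual. -/
noncomputable def fromResidual (ρ : Fin d → ℝ) (p : ℝ × (Fin d → ℝ)) (k : Fin d) : ℝ :=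
  normToExp (ρ k * expToNorm p.1 + p.2 k)

lemma measurable_fromResidual (ρ : Fin d → ℝ) : Measurable (fromResidual ρ) := by
  refine measurable_pi_lambda _ fun k => continuous_normToExp.measurable.comp ?_
  have := measurable_expToNorm
  fun_prop

lemma measurable_fromResidual_mk (ρ : Fin d → ℝ) (v : ℝ) :
    Measurable fun x => fromResidual ρ (v, x) :=
  (measurable_fromResidual ρ).comp measurable_prodMk_left

/-- The conditional law of the exponential-scale vector when the residual has law `ν`. -/
noncomputable def residualKernel (ρ : Fin d → ℝ) (ν : Measure (Fin d → ℝ)) :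
    Kernel ℝ (Fin d → ℝ) :=
  (Kernel.id ×ₖ Kernel.const ℝ ν).map (fromResidual ρ)

lemma residualKernel_apply (ρ : Fin d → ℝ) (ν : Measure (Fin d → ℝ)) [IsProbabilityMeasure ν]
    (v : ℝ) : residualKernel ρ ν v = ν.map (fun x => fromResidual ρ (v, x)) := by
  rw [residualKernel, Kernel.map_apply _ (measurable_fromResidual ρ), Kernel.prod_apply,
    Kernel.id_apply, Kernel.const_apply, Measure.dirac_prod,
    Measure.map_map (measurable_fromResidual ρ) measurable_prodMk_left]
  rfl

/-- `expToNorm` recovers `U` from the conditioning variable, so by independence the joint law is an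
image of a product measure. Weak continuity is dominated convergence. -/
lemma isContCondDistrib_residualKernel [IsProbabilityMeasure P] (ρ : Fin d → ℝ) {U : Ω → ℝ} {Z : Ω → Fin d → ℝ}
    (hU : AEMeasurable U P) (hZ : AEMeasurable Z P) (hUZ : IndepFun U Z P) :
    IsContCondDistrib P (fun ω => normToExp (U ω))
      (fun ω k => normToExp (ρ k * U ω + Z ω k)) (residualKernel ρ (P.map Z)) := by
  have hν : IsProbabilityMeasure (P.map Z) := Measure.isProbabilityMeasure_map hZ
  have hmeas := measurable_fromResidual ρ
  have hmeas' := measurable_fromResidual_mk ρ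
  have hmarkov : IsMarkovKernel (residualKernel ρ (P.map Z)) :=
    Kernel.IsMarkovKernel.map _ hmeas
  have hV : AEMeasurable (fun ω => normToExp (U ω)) P :=
    continuous_normToExp.measurable.comp_aemeasurable hU
  refine ⟨hmarkov, ?_, fun f => ?_⟩
  · have hind : IndepFun (fun ω => normToExp (U ω)) Z P :=
      hUZ.comp continuous_normToExp.measurable measurable_id
    have hprod := hind.map_prod_eq_prod_map_map hV hZ
    have hg : Measurable fun p : ℝ × (Fin d → ℝ) => (p.1, fromResidual ρ p) :=
      measurable_fst.prodMk hmeas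
    have hright : P.map (fun ω => (normToExp (U ω), fun k => normToExp (ρ k * U ω + Z ω k))) =
        ((P.map fun ω => normToExp (U ω)).prod (P.map Z)).map
          (fun p => (p.1, fromResidual ρ p)) := by
      rw [← hprod, AEMeasurable.map_map_of_aemeasurable hg.aemeasurable (hV.prodMk hZ)]
      congr 1
      funext ω
      simp only [Function.comp_apply]
      congr 1
      funext k
      simp [fromResidual, expToNorm_normToExp]
    have : IsProbabilityMeasure (P.map fun ω => normToExp (U ω)) :=
      Measure.isProbabilityMeasure_map hV
    rw [hright]
    ext s hs
    rw [Measure.compProd_apply hs, Measure.map_apply hg hs, Measure.prod_apply (hg hs)]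
    refine lintegral_congr fun v => ?_
    rw [residualKernel_apply, Measure.map_apply (hmeas' v) (measurable_prodMk_left hs)]
    rfl
  · have h : ∀ v, ∫ x, f x ∂(residualKernel ρ (P.map Z) v)
        = ∫ x, f (fromResidual ρ (v, x)) ∂(P.map Z) := by
      intro v
      rw [residualKernel_apply, integral_map (hmeas' v).aemeasurable
        f.continuous.aestronglyMeasurable]
    simp_rw [h]
    refine continuousOn_of_dominated (bound := fun _ => ‖f‖) (fun v _ => ?_)
      (fun v _ => Eventually.of_forall fun x => f.norm_coe_le_norm _) (integrable_const _)
      (Eventually.of_forall fun x => ?_)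
    · exact (f.continuous.measurable.comp (hmeas' v)).aestronglyMeasurable
    · refine f.continuous.comp_continuousOn (continuousOn_pi.2 fun k => ?_)
      refine continuous_normToExp.comp_continuousOn ?_
      have : ContinuousOn expToNorm (Set.Ioi 0) := fun v hv =>
        (continuousAt_expToNorm hv).continuousWithinAt
      exact (this.const_mul (ρ k)).add continuousOn_const

/-- By monotonicity of `T`, the event is `ρ_k S(v) + Z_k ≤ S(a_k + b_k w_k)`. Positivity of `a_k +
b_k w_k` is required because `S` inverts `T` only on `(0, ∞)`. -/
lemma normCondCDF_residualKernel {ρ : Fin d → ℝ} (hρ : ∀ k, 0 < ρ k)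
    {S : Matrix (Fin d) (Fin d) ℝ} {ν : Measure (Fin d → ℝ)}
    (hν : ν = (multivariateGaussian 0 S).map WithLp.ofLp)
    {v : ℝ} {w : Fin d → ℝ} (hw : ∀ k, 0 < affinePoint ρ k (w k) v) :
    normCondCDF (residualKernel ρ ν) (loc ρ) (scale ρ) v w =
      gaussCDF S fun k => residualPoint ρ k (w k) v := by
  have : IsProbabilityMeasure ν := by
    rw [hν]
    exact Measure.isProbabilityMeasure_map (by fun_prop)
  have hset : {x : Fin d → ℝ | ∀ k, (x k - loc ρ k v) / scale ρ k v ≤ w k} =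
      Set.Iic fun k => affinePoint ρ k (w k) v := by
    ext x
    simp only [Set.mem_ofPred_eq, Set.mem_Iic, Pi.le_def]
    refine forall_congr' fun k => ?_
    rw [div_le_iff₀ (scale_pos (hρ k) v), sub_le_iff_le_add', affinePoint, mul_comm]
  rw [normCondCDF, hset, residualKernel_apply, map_measureReal_apply
    (measurable_fromResidual_mk ρ v) measurableSet_Iic, hν, map_measureReal_apply (by fun_prop)
      (measurable_fromResidual_mk ρ v measurableSet_Iic), gaussCDF]
  congr 1
  ext x
  simp only [Set.mem_preimage, Set.mem_Iic, Set.mem_ofPred_eq, Pi.le_def]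
  refine forall_congr' fun k => ?_
  rw [fromResidual, normToExp_le_iff (hw k), residualPoint, le_sub_iff_add_le, add_comm]

end CondDistrib

/-! ### Scaling the covariance matrix -/

lemma gaussCDF_smul {d : ℕ} {S : Matrix (Fin d) (Fin d) ℝ} (hS : S.PosSemidef) {c : ℝ}
    (hc : 0 < c) (z : Fin d → ℝ) : gaussCDF (c • S) z = gaussCDF S fun k => z k / √c := by
  have hs : 0 < √c := Real.sqrt_pos.2 hc
  have h : multivariateGaussian 0 (c • S) = (multivariateGaussian 0 S).map (√c • ·) := by
    have : IsProbabilityMeasure ((multivariateGaussian 0 S).map (√c • ·)) :=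
      Measure.isProbabilityMeasure_map (by fun_prop)
    apply Measure.ext_of_charFun
    ext t
    rw [charFun_map_smul, charFun_multivariateGaussian (hS.smul hc.le),
      charFun_multivariateGaussian hS]
    have : (√c • t).ofLp ⬝ᵥ S.mulVec (√c • t).ofLp = t.ofLp ⬝ᵥ (c • S).mulVec t.ofLp := by
      simp only [WithLp.ofLp_smul, Matrix.mulVec_smul, Matrix.smul_mulVec, smul_dotProduct,
        dotProduct_smul, smul_smul, Real.mul_self_sqrt hc.le]
    rw [this]
    simp
  rw [gaussCDF, h, map_measureReal_apply (by fun_prop) (measurableSet_orthant z), gaussCDF]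
  congr 1
  ext x
  simp [le_div_iff₀ hs, mul_comm]

/-! ### Standardisation and regression of a Gaussian vector -/

section GaussianVector

variable {Ω : Type*} [MeasurableSpace Ω] {P : Measure Ω} {d : ℕ}

/-- The standardisation of a real random variable. -/
noncomputable def standardize (P : Measure Ω) (X : Ω → ℝ) (ω : Ω) : ℝ :=
  (X ω - P[X]) / √(Var[X; P])

/-- The residuals of the regression of the standardised `Y_k` on the standardised `Y_0`. -/
noncomputable def regResidual (P : Measure Ω) (Y : Fin (d + 1) → Ω → ℝ) (ω : Ω) (k : Fin d) : ℝ :=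
  standardize P (Y k.succ) ω - rhoZero P Y k * standardize P (Y 0) ω

lemma corr_comm (X Y : Ω → ℝ) : corr P X Y = corr P Y X := by
  rw [corr, corr, covariance_comm, mul_comm]

lemma corr_self {X : Ω → ℝ} (hX : AEMeasurable X P) (hv : 0 < Var[X; P]) : corr P X X = 1 := by
  rw [corr, covariance_self hX, Real.mul_self_sqrt hv.le, div_self hv.ne']

lemma covariance_standardize [IsProbabilityMeasure P] {X Y : Ω → ℝ} (hX : Integrable X P)
    (hY : Integrable Y P) : cov[standardize P X, standardize P Y; P] = corr P X Y := by
  unfold standardize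
  rw [covariance_fun_div_left, covariance_fun_div_right, covariance_sub_const_left hX,
    covariance_sub_const_right hY, corr, div_div, mul_comm]

lemma memLp_standardize [IsProbabilityMeasure P] {X : Ω → ℝ} (hX : MemLp X 2 P) :
    MemLp (standardize P X) 2 P := by
  have := (hX.sub (memLp_const P[X])).mul_const (√(Var[X; P]))⁻¹
  simpa [standardize, div_eq_mul_inv] using! this

lemma integral_standardize [IsProbabilityMeasure P] {X : Ω → ℝ} (hX : Integrable X P) :
    P[standardize P X] = 0 := by
  unfold standardize
  rw [integral_div, integral_sub hX (integrable_const _)]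
  simp

lemma map_standardize {X : Ω → ℝ} (hX : HasGaussianLaw X P) (hv : 0 < Var[X; P]) :
    P.map (standardize P X) = gaussianReal 0 1 := by
  have h : HasLaw X (gaussianReal P[X] Var[X; P].toNNReal) P :=
    ⟨hX.aemeasurable, hX.map_eq_gaussianReal⟩
  have h2 := (gaussianReal_div_const (gaussianReal_sub_const h P[X]) (√(Var[X; P]))).map_eq
  unfold standardize
  rw [h2]
  congr 1
  · simp
  · ext
    simp [Real.coe_toNNReal _ hv.le, Real.sq_sqrt hv.le, hv.ne']

lemma toExp_eq_normToExp_standardize {X : Ω → ℝ} (hX : HasGaussianLaw X P)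
    (hv : 0 < Var[X; P]) : toExp P X = fun ω => normToExp (standardize P X ω) := by
  have := hX.isProbabilityMeasure
  have : IsProbabilityMeasure (P.map X) := Measure.isProbabilityMeasure_map hX.aemeasurable
  funext ω
  rw [toExp, normToExp, stdCDF, ← map_standardize hX hv]
  have : IsProbabilityMeasure (P.map (standardize P X)) := by
    rw [map_standardize hX hv]
    infer_instance
  have hm : Measurable fun x : ℝ => (x - P[X]) / √(Var[X; P]) := by fun_prop
  have hc : P.map (standardize P X) = (P.map X).map fun x => (x - P[X]) / √(Var[X; P]) := by
    rw [AEMeasurable.map_map_of_aemeasurable hm.aemeasurable hX.aemeasurable]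
    rfl
  rw [cdf_eq_real, cdf_eq_real, hc, map_measureReal_apply hm measurableSet_Iic]
  congr 4
  ext x
  have hs := Real.sqrt_pos.2 hv
  simp [standardize, div_le_div_iff_of_pos_right hs]

variable {Y : Fin (d + 1) → Ω → ℝ}

lemma variance_pos_of_posDef (hY : HasGaussianLaw (fun ω i => Y i ω) P)
    (hS : (Matrix.of fun i j => cov[Y i, Y j; P]).PosDef) (i : Fin (d + 1)) :
    0 < Var[Y i; P] := by
  have h := hS.diag_pos (i := i)
  rwa [Matrix.of_apply, covariance_self (hY.eval i).aemeasurable] at h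

lemma hasGaussianLaw_standardize (hY : HasGaussianLaw (fun ω i => Y i ω) P) :
    HasGaussianLaw (fun ω i => standardize P (Y i) ω) P := by
  have hc : HasGaussianLaw (fun ω i => Y i ω - P[Y i]) P := by
    have := hY.isGaussian_map
    have h : P.map (fun ω i => Y i ω - P[Y i]) =
        (P.map fun ω i => Y i ω).map fun x => x - fun i => P[Y i] := by
      rw [AEMeasurable.map_map_of_aemeasurable (by fun_prop) hY.aemeasurable]
      rfl
    exact ⟨by rw [h]; infer_instance⟩
  let L : (Fin (d + 1) → ℝ) →L[ℝ] (Fin (d + 1) → ℝ) := ContinuousLinearMap.pi fun i =>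
    (√(Var[Y i; P]))⁻¹ • (ContinuousLinearMap.proj i)
  have h : (fun ω i => standardize P (Y i) ω) = fun ω => L fun i => Y i ω - P[Y i] := by
    funext ω i
    simp [L, standardize, div_eq_inv_mul]
  rw [h]
  exact hc.map_fun L

/-- Joint Gaussianity turns zero covariance into independence. The scalar is wrapped as `Unit → ℝ`
to fit the criterion for families. -/
lemma hasGaussianLaw_standardize_residual (hY : HasGaussianLaw (fun ω i => Y i ω) P) :
    HasGaussianLaw (fun ω => ((fun _ : Unit => standardize P (Y 0) ω), regResidual P Y ω)) P := by
  let L : (Fin (d + 1) → ℝ) →L[ℝ] (Unit → ℝ) × (Fin d → ℝ) :=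
    (ContinuousLinearMap.pi fun _ => ContinuousLinearMap.proj 0).prod
      (ContinuousLinearMap.pi fun k : Fin d =>
        ContinuousLinearMap.proj k.succ - rhoZero P Y k • ContinuousLinearMap.proj 0)
  exact (hasGaussianLaw_standardize hY).map_fun L

lemma covariance_residual (hY : HasGaussianLaw (fun ω i => Y i ω) P)
    (hS : (Matrix.of fun i j => cov[Y i, Y j; P]).PosDef) (k l : Fin d) :
    cov[fun ω => regResidual P Y ω k, fun ω => regResidual P Y ω l; P] = sigmaZero P Y k l := by
  have := hY.isProbabilityMeasure
  have hU : ∀ i, MemLp (standardize P (Y i)) 2 P := fun i =>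
    memLp_standardize (hY.eval i).memLp_two
  have hint : ∀ i, Integrable (Y i) P := fun i => (hY.eval i).integrable
  unfold regResidual
  rw [covariance_fun_sub_fun_sub (hU _) ((hU 0).const_mul _) (hU _) ((hU 0).const_mul _)]
  simp only [covariance_const_mul_left, covariance_const_mul_right,
    covariance_standardize (hint _) (hint _),
    corr_self (hY.eval 0).aemeasurable (variance_pos_of_posDef hY hS 0), sigmaZero,
    Matrix.of_apply, rhoZero, corr_comm (Y 0)]
  ring

lemma covariance_standardize_residual (hY : HasGaussianLaw (fun ω i => Y i ω) P)
    (hS : (Matrix.of fun i j => cov[Y i, Y j; P]).PosDef) (k : Fin d) :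
    cov[standardize P (Y 0), fun ω => regResidual P Y ω k; P] = 0 := by
  have := hY.isProbabilityMeasure
  have hU : ∀ i, MemLp (standardize P (Y i)) 2 P := fun i =>
    memLp_standardize (hY.eval i).memLp_two
  have hint : ∀ i, Integrable (Y i) P := fun i => (hY.eval i).integrable
  unfold regResidual
  rw [covariance_fun_sub_right (hU 0) (hU _) ((hU 0).const_mul _), covariance_const_mul_right,
    covariance_standardize (hint _) (hint _), covariance_standardize (hint _) (hint _),
    corr_self (hY.eval 0).aemeasurable (variance_pos_of_posDef hY hS 0), rhoZero, corr_comm (Y 0)]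
  ring

lemma indepFun_standardize_residual (hY : HasGaussianLaw (fun ω i => Y i ω) P)
    (hS : (Matrix.of fun i j => cov[Y i, Y j; P]).PosDef) :
    IndepFun (standardize P (Y 0)) (regResidual P Y) P := by
  have h := HasGaussianLaw.indepFun_of_covariance_eval
    (X := fun _ : Unit => standardize P (Y 0)) (Y := fun k ω => regResidual P Y ω k)
    (hasGaussianLaw_standardize_residual hY) fun _ k => covariance_standardize_residual hY hS k
  exact h.comp (φ := fun x : Unit → ℝ => x ()) (ψ := id) (by fun_prop) measurable_id

lemma posDef_sigmaZero (hY : HasGaussianLaw (fun ω i => Y i ω) P)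
    (hS : (Matrix.of fun i j => cov[Y i, Y j; P]).PosDef) : (sigmaZero P Y).PosDef := by
  have hs : ∀ i, √(Var[Y i; P]) ≠ 0 := fun i =>
    (Real.sqrt_pos.2 (variance_pos_of_posDef hY hS i)).ne'
  -- `B` holds the coefficients of the residuals in terms of the centred `Y_i`, so `Σ₀` is `B C Bᴴ`
  -- with `C` the covariance matrix of `Y`. Its last `d` columns form an invertible diagonal block,
  -- whence injectivity.
  let B : Matrix (Fin d) (Fin (d + 1)) ℝ := Matrix.of fun k =>
    Fin.cons (-(rhoZero P Y k / √(Var[Y 0; P])))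
      (fun l => if k = l then (√(Var[Y k.succ; P]))⁻¹ else 0)
  have hB : Function.Injective B.vecMul := by
    intro x y hxy
    funext l
    have h := congrFun hxy l.succ
    simpa [Matrix.vecMul, dotProduct, B, hs] using h
  have hself : cov[Y 0, Y 0; P] = √(Var[Y 0; P]) ^ 2 := by
    rw [covariance_self (hY.eval 0).aemeasurable, Real.sq_sqrt (variance_nonneg _ _)]
  convert hS.mul_mul_conjTranspose_same hB using 1
  ext k l
  have h0 := hs 0
  have hk := hs k.succ
  have hl := hs l.succ
  simp only [Matrix.mul_apply, Fin.sum_univ_succ, Matrix.conjTranspose_apply, B, Matrix.of_apply,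
    Fin.cons_zero, Fin.cons_succ, ite_mul, zero_mul, Finset.sum_ite_eq, Finset.mem_univ, if_true,
    star_trivial, mul_ite, mul_zero, hself, sigmaZero, rhoZero, corr,
    covariance_comm (Y 0) (Y l.succ)]
  field_simp
  ring

lemma integral_residual (hY : HasGaussianLaw (fun ω i => Y i ω) P) (k : Fin d) :
    ∫ ω, regResidual P Y ω k ∂P = 0 := by
  have := hY.isProbabilityMeasure
  have hU : ∀ i, Integrable (standardize P (Y i)) P := fun i =>
    (memLp_standardize (hY.eval i).memLp_two).integrable (by norm_num)
  unfold regResidual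
  rw [integral_sub (hU _) ((hU 0).const_mul _), integral_const_mul,
    integral_standardize (hY.eval _).integrable, integral_standardize (hY.eval _).integrable]
  simp

/-- A Gaussian law is determined by its mean and covariance. The comparison takes place on
`EuclideanSpace`, where `multivariateGaussian` lives. -/
lemma map_residual (hY : HasGaussianLaw (fun ω i => Y i ω) P)
    (hS : (Matrix.of fun i j => cov[Y i, Y j; P]).PosDef) :
    P.map (regResidual P Y) = (multivariateGaussian 0 (sigmaZero P Y)).map WithLp.ofLp := by
  have := hY.isProbabilityMeasure
  have hZ : HasGaussianLaw (regResidual P Y) P := (hasGaussianLaw_standardize_residual hY).snd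
  have hZ2 : HasGaussianLaw (fun ω => WithLp.toLp 2 (regResidual P Y ω)) P :=
    hZ.map_equiv_fun (PiLp.continuousLinearEquiv 2 ℝ (fun _ : Fin d => ℝ)).symm
  have hG := hZ2.isGaussian_map
  have key : P.map (fun ω => WithLp.toLp 2 (regResidual P Y ω)) =
      multivariateGaussian 0 (sigmaZero P Y) := by
    apply IsGaussian.ext
    · rw [integral_map hZ2.aemeasurable (by fun_prop)]
      simp only [id_eq, integral_id_multivariateGaussian]
      ext k
      have h := (EuclideanSpace.proj k : EuclideanSpace ℝ (Fin d) →L[ℝ] ℝ).integral_comp_comm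
        hZ2.integrable
      exact h.symm.trans (integral_residual hY k)
    rw [← ContinuousLinearMap.toBilinForm_inj]
    refine LinearMap.BilinForm.ext_basis (EuclideanSpace.basisFun (Fin d) ℝ).toBasis
      fun i j => ?_
    rw [ContinuousLinearMap.toBilinForm_apply, ContinuousLinearMap.toBilinForm_apply,
      covarianceBilin_apply_eq_cov IsGaussian.memLp_two_id,
      covariance_map (by fun_prop) (by fun_prop) hZ2.aemeasurable,
      covarianceBilin_multivariateGaussian (posDef_sigmaZero hY hS).posSemidef]
    have h : ∀ i : Fin d, (fun u => inner ℝ ((EuclideanSpace.basisFun (Fin d) ℝ).toBasis i) u) ∘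
        (fun ω => WithLp.toLp 2 (regResidual P Y ω)) = fun ω => regResidual P Y ω i := by
      intro i
      ext ω
      simp [PiLp.inner_apply]
    rw [h, h, covariance_residual hY hS]
    simp
  rw [← key, AEMeasurable.map_map_of_aemeasurable (by fun_prop) hZ2.aemeasurable]
  rfl

end GaussianVector

/-! ### Regularity of the normalising functions -/

section Normalisation

variable {d : ℕ} {ρ₀ : Fin d → ℝ} {k : Fin d}

lemma deriv_loc : deriv (loc ρ₀ k) = fun _ => ρ₀ k ^ 2 := by
  funext v
  simpa only [mul_one] using! ((hasDerivAt_id v).const_mul (ρ₀ k ^ 2)).deriv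

lemma contDiff_loc : ContDiff ℝ 2 (loc ρ₀ k) := contDiff_const.mul contDiff_id

lemma contDiffAt_scale {v : ℝ} (hv : 0 < v) : ContDiffAt ℝ 2 (scale ρ₀ k) v :=
  contDiffAt_const.add (contDiffAt_const.mul (Real.contDiffAt_sqrt hv.ne'))

lemma tendsto_deriv_scale_div_scale (hρ : 0 < ρ₀ k) :
    Tendsto (fun v => deriv (scale ρ₀ k) v / scale ρ₀ k v) atTop (𝓝 0) := by
  have hscale : Tendsto (scale ρ₀ k) atTop atTop :=
    tendsto_atTop_add_const_left _ 1 (Real.tendsto_sqrt_atTop.const_mul_atTop hρ)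
  have hd : Tendsto (deriv (scale ρ₀ k)) atTop (𝓝 0) := by
    have h := (tendsto_inv_atTop_zero.comp Real.tendsto_sqrt_atTop).const_mul (ρ₀ k / 2)
    rw [mul_zero] at h
    refine h.congr' ?_
    filter_upwards [eventually_gt_atTop 0] with v hv
    have h1 : HasDerivAt (scale ρ₀ k) (ρ₀ k * (1 / (2 * √v))) v :=
      ((Real.hasDerivAt_sqrt hv.ne').const_mul (ρ₀ k)).const_add 1
    have := (Real.sqrt_pos.2 hv).ne'
    rw [h1.deriv, Function.comp_apply]
    field_simp
  exact hd.div_atTop hscale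

end Normalisation

/-! ### Derivatives of the normalised transformation -/

section ResidualPoint

variable {d : ℕ} {ρ₀ : Fin d → ℝ} {k : Fin d} {v t : ℝ}

lemma hasDerivAt_affinePoint (ρ₀ : Fin d → ℝ) (k : Fin d) (v t : ℝ) :
    HasDerivAt (fun t => affinePoint ρ₀ k t v) (scale ρ₀ k v) t := by
  simpa only [mul_one] using! ((hasDerivAt_id t).const_mul (scale ρ₀ k v)).const_add (loc ρ₀ k v)

lemma isOpen_affinePoint_pos (ρ₀ : Fin d → ℝ) (k : Fin d) (v : ℝ) :
    IsOpen {t | 0 < affinePoint ρ₀ k t v} :=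
  isOpen_lt continuous_const (continuous_iff_continuousAt.2 fun t =>
    (hasDerivAt_affinePoint ρ₀ k v t).continuousAt)

lemma hasDerivAt_residualPoint (h : 0 < affinePoint ρ₀ k t v) :
    HasDerivAt (fun t => residualPoint ρ₀ k t v)
      (scale ρ₀ k v * deriv expToNorm (affinePoint ρ₀ k t v)) t := by
  rw [mul_comm]
  exact ((hasDerivAt_expToNorm h).differentiableAt.hasDerivAt.comp t
    (hasDerivAt_affinePoint ρ₀ k v t)).sub_const _

lemma hasDerivAt_scale_mul_deriv_expToNorm (h : 0 < affinePoint ρ₀ k t v) :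
    HasDerivAt (fun t => scale ρ₀ k v * deriv expToNorm (affinePoint ρ₀ k t v))
      (scale ρ₀ k v ^ 2 * deriv (deriv expToNorm) (affinePoint ρ₀ k t v)) t := by
  have h1 := ((hasDerivAt_deriv_expToNorm h).differentiableAt.hasDerivAt.comp t
    (hasDerivAt_affinePoint ρ₀ k v t)).const_mul (scale ρ₀ k v)
  convert! h1 using 1
  ring

lemma contDiffAt_residualPoint (h : 0 < affinePoint ρ₀ k t v) :
    ContDiffAt ℝ (⊤ : ℕ∞) (fun t => residualPoint ρ₀ k t v) t := by
  have h1 : ContDiffAt ℝ (⊤ : ℕ∞) expToNorm (affinePoint ρ₀ k t v) :=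
    contDiffOn_expToNorm.contDiffAt (Ioi_mem_nhds h)
  have h2 : ContDiff ℝ (⊤ : ℕ∞) fun t => affinePoint ρ₀ k t v := by
    unfold affinePoint
    fun_prop
  exact (h1.comp t h2.contDiffAt).sub contDiffAt_const

end ResidualPoint

/-! ### Convergence of the normalised conditional distribution functions -/

section Convergence

variable {d : ℕ} {ρ : Fin d → ℝ} {f : (Fin d → ℝ) → ℝ} {F : ℝ → (Fin d → ℝ) → ℝ}

lemma eventually_affinePoint_pos (hρ : ∀ k, 0 < ρ k) (z : Fin d → ℝ) :
    ∀ᶠ v in atTop, ∀ k, 0 < affinePoint ρ k (z k) v :=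
  eventually_all.2 fun k => (tendsto_affinePoint_atTop (z k) (hρ k)).eventually_gt_atTop 0

lemma eventuallyEq_comp_residualPoint (hρ : ∀ k, 0 < ρ k)
    (hF : ∀ v > 0, ∀ w : Fin d → ℝ, (∀ k, 0 < affinePoint ρ k (w k) v) →
      F v w = f fun k => residualPoint ρ k (w k) v) (z : Fin d → ℝ) :
    ∀ᶠ v in atTop, F v =ᶠ[𝓝 z] fun w => f fun k => residualPoint ρ k (w k) v := by
  filter_upwards [eventually_affinePoint_pos hρ z, eventually_gt_atTop 0] with v hz hv
  filter_upwards [(isOpen_forall_mem fun k => isOpen_affinePoint_pos ρ k v).mem_nhds hz]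
    with w hw using hF v hv w hw

lemma eventually_contDiffAt (hρ : ∀ k, 0 < ρ k) (hf : ContDiff ℝ (⊤ : ℕ∞) f)
    (hF : ∀ v > 0, ∀ w : Fin d → ℝ, (∀ k, 0 < affinePoint ρ k (w k) v) →
      F v w = f fun k => residualPoint ρ k (w k) v) (z : Fin d → ℝ) :
    ∀ᶠ v in atTop, ContDiffAt ℝ (⊤ : ℕ∞) (F v) z := by
  filter_upwards [eventually_affinePoint_pos hρ z, eventuallyEq_comp_residualPoint hρ hF z]
    with v hz hFv
  refine ContDiffAt.congr_of_eventuallyEq ?_ hFv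
  refine hf.contDiffAt.comp z (contDiffAt_pi.2 fun k => ?_)
  exact (contDiffAt_residualPoint (hz k)).comp z (contDiff_apply ℝ ℝ k).contDiffAt

lemma tendsto_iterPartial_comp_residualPoint (hρ : ∀ k, 0 < ρ k) (hf : ContDiff ℝ (⊤ : ℕ∞) f)
    (l : List (Fin d)) (z : Fin d → ℝ) :
    Tendsto (fun v => iterPartial l f fun k => residualPoint ρ k (z k) v) atTop
      (𝓝 (iterPartial l f fun k => z k / √2)) :=
  ((contDiff_iterPartial hf l).continuous.tendsto _).comp
    (tendsto_pi_nhds.2 fun k => tendsto_residualPoint (z k) (hρ k))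

lemma tendsto_iterPartial_of_nodup (hρ : ∀ k, 0 < ρ k) (hf : ContDiff ℝ (⊤ : ℕ∞) f)
    (hF : ∀ v > 0, ∀ w : Fin d → ℝ, (∀ k, 0 < affinePoint ρ k (w k) v) →
      F v w = f fun k => residualPoint ρ k (w k) v) {l : List (Fin d)} (hl : l.Nodup)
    (z : Fin d → ℝ) :
    Tendsto (fun v => iterPartial l (F v) z) atTop
      (𝓝 (iterPartial l f (fun k => z k / √2) / √2 ^ l.length)) := by
  have hprod : Tendsto (fun v => (l.map fun k =>
      scale ρ k v * deriv expToNorm (affinePoint ρ k (z k) v)).prod) atTop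
      (𝓝 (l.map fun _ => (√2)⁻¹).prod) :=
    tendsto_list_prod l fun k _ => tendsto_scale_mul_deriv_expToNorm (z k) (hρ k)
  have h := (tendsto_iterPartial_comp_residualPoint hρ hf l z).mul hprod
  rw [List.map_const', List.prod_replicate, inv_pow, ← div_eq_mul_inv] at h
  refine h.congr' ?_
  filter_upwards [eventually_affinePoint_pos hρ z, eventuallyEq_comp_residualPoint hρ hF z]
    with v hz hFv
  rw [(iterPartial_congr hFv l).self_of_nhds]
  exact (iterPartial_comp_coordinatewise (g := fun k t => residualPoint ρ k t v) hf
    (fun k => isOpen_affinePoint_pos ρ k v) (fun k t ht => hasDerivAt_residualPoint ht) hl hz).symm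

/-- The product rule adds a term `∂_k f · τ_k''`, which disappears in the limit because `τ_k'' → 0`.
-/
lemma tendsto_iterPartial_pair (hρ : ∀ k, 0 < ρ k) (hf : ContDiff ℝ (⊤ : ℕ∞) f)
    (hF : ∀ v > 0, ∀ w : Fin d → ℝ, (∀ k, 0 < affinePoint ρ k (w k) v) →
      F v w = f fun k => residualPoint ρ k (w k) v) (k : Fin d) (z : Fin d → ℝ) :
    Tendsto (fun v => iterPartial [k, k] (F v) z) atTop
      (𝓝 (iterPartial [k, k] f (fun k => z k / √2) / √2 ^ [k, k].length)) := by
  have h := ((tendsto_iterPartial_comp_residualPoint hρ hf [k, k] z).mul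
    ((tendsto_scale_mul_deriv_expToNorm (z k) (hρ k)).pow 2)).add
    ((tendsto_iterPartial_comp_residualPoint hρ hf [k] z).mul
      (tendsto_scale_sq_mul_deriv_deriv_expToNorm (z k) (hρ k)))
  rw [mul_zero, add_zero, inv_pow, ← div_eq_mul_inv] at h
  refine h.congr' ?_
  filter_upwards [eventually_affinePoint_pos hρ z, eventuallyEq_comp_residualPoint hρ hF z]
    with v hz hFv
  rw [(iterPartial_congr hFv [k, k]).self_of_nhds]
  exact (iterPartial_pair_comp_coordinatewise (g := fun k t => residualPoint ρ k t v) hf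
    (fun k => isOpen_affinePoint_pos ρ k v) (fun k t ht => hasDerivAt_residualPoint ht)
    (fun k t ht => hasDerivAt_scale_mul_deriv_expToNorm ht) k hz).symm

end Convergence

end GaussCopula

/-! ### The main theorem -/

open GaussCopula

theorem mainTheorem5 {Ω : Type*} [MeasurableSpace Ω] (P : Measure Ω) [IsProbabilityMeasure P]
    {d : ℕ} (Y : Fin (d + 1) → Ω → ℝ)
    (hY : HasGaussianLaw (fun ω i => Y i ω) P)
    (hS : (Matrix.of fun i j => cov[Y i, Y j; P]).PosDef)
    (hρ : ∀ k : Fin d, 0 < GaussCopula.rhoZero P Y k)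
    (V : Fin (d + 1) → Ω → ℝ) (hV : ∀ i, V i = GaussCopula.toExp P (Y i))
    (a b : Fin d → ℝ → ℝ)
    (ha : a = GaussCopula.loc (GaussCopula.rhoZero P Y))
    (hb : b = GaussCopula.scale (GaussCopula.rhoZero P Y))
    (G : (Fin d → ℝ) → ℝ)
    (hG : G = GaussCopula.gaussCDF ((2 : ℝ) • GaussCopula.sigmaZero P Y)) :
    -- the margins are unit exponential
    (∀ i, P.map (V i) = expMeasure 1) ∧
    -- the normalising functions satisfy the regularity conditions
    (∀ k, (∀ v, 0 < v → ContDiffAt ℝ 2 (a k) v ∧ ContDiffAt ℝ 2 (b k) v) ∧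
      Tendsto (deriv (a k)) atTop (𝓝 (GaussCopula.rhoZero P Y k ^ 2)) ∧
      Tendsto (deriv (deriv (a k))) atTop (𝓝 0) ∧
      Tendsto (fun v => deriv (b k) v / b k v) atTop (𝓝 0)) ∧
    -- the limit distribution function is smooth, and its partial derivatives in terms of `Φ_d`
    ContDiff ℝ (⊤ : ℕ∞) G ∧
    (∀ (l : List (Fin d)) (z : Fin d → ℝ),
      GaussCopula.iterPartial l G z =
        GaussCopula.iterPartial l (GaussCopula.gaussCDF (GaussCopula.sigmaZero P Y))
          (fun k => z k / √2) / √2 ^ l.length) ∧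
    -- the conditional law of `(V_1, …, V_d)` given `V_0 = v` exists as a continuous version
    (∃ κ : Kernel ℝ (Fin d → ℝ),
      GaussCopula.IsContCondDistrib P (V 0) (fun ω k => V (Fin.succ k) ω) κ) ∧
    ∀ κ : Kernel ℝ (Fin d → ℝ),
      GaussCopula.IsContCondDistrib P (V 0) (fun ω k => V (Fin.succ k) ω) κ →
      ∀ z : Fin d → ℝ,
        -- the normalised conditional distribution function is smooth near `z` for all large `v`
        (∀ᶠ v in atTop, ContDiffAt ℝ (⊤ : ℕ∞) (GaussCopula.normCondCDF κ a b v) z) ∧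
        -- mixed partial derivatives in distinct variables (including order zero)
        (∀ l : List (Fin d), l.Nodup →
          Tendsto (fun v => GaussCopula.iterPartial l (GaussCopula.normCondCDF κ a b v) z) atTop
            (𝓝 (GaussCopula.iterPartial l G z))) ∧
        -- pure second derivatives
        (∀ k : Fin d,
          Tendsto (fun v => GaussCopula.iterPartial [k, k] (GaussCopula.normCondCDF κ a b v) z)
            atTop (𝓝 (GaussCopula.iterPartial [k, k] G z))) := by
  subst ha hb
  have hpd := posDef_sigmaZero hY hS
  have hsmooth := contDiff_gaussCDF hpd
  have hGeq : G = fun z => gaussCDF (sigmaZero P Y) fun k => z k / √2 := by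
    rw [hG]
    exact funext (gaussCDF_smul hpd.posSemidef two_pos)
  have hGpartial : ∀ (l : List (Fin d)) (z : Fin d → ℝ), iterPartial l G z =
      iterPartial l (gaussCDF (sigmaZero P Y)) (fun k => z k / √2) / √2 ^ l.length := by
    rw [hGeq]
    exact iterPartial_comp_div _ _
  have hvar := variance_pos_of_posDef hY hS
  have hVeq : ∀ i, V i = fun ω => normToExp (standardize P (Y i) ω) := fun i => by
    rw [hV, toExp_eq_normToExp_standardize (hY.eval i) (hvar i)]
  have hU : ∀ i, AEMeasurable (standardize P (Y i)) P := fun i =>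
    (memLp_standardize (hY.eval i).memLp_two).aestronglyMeasurable.aemeasurable
  have hexp : ∀ i, P.map (V i) = expMeasure 1 := fun i => by
    rw [hVeq, ← map_normToExp_gaussianReal, ← map_standardize (hY.eval i) (hvar i),
      AEMeasurable.map_map_of_aemeasurable continuous_normToExp.aemeasurable (hU i)]
    rfl
  have hker : IsContCondDistrib P (V 0) (fun ω k => V (Fin.succ k) ω)
      (residualKernel (rhoZero P Y) (P.map (regResidual P Y))) := by
    have h := isContCondDistrib_residualKernel (rhoZero P Y) (hU 0)
      (hasGaussianLaw_standardize_residual hY).snd.aemeasurable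
      (indepFun_standardize_residual hY hS)
    simpa [hVeq, regResidual] using h
  refine ⟨hexp, fun k => ⟨fun v hv => ⟨contDiff_loc.contDiffAt, contDiffAt_scale hv⟩, ?_, ?_,
    tendsto_deriv_scale_div_scale (hρ k)⟩, ?_, hGpartial, ⟨_, hker⟩, fun κ hκ z => ?_⟩
  · rw [deriv_loc]
    exact tendsto_const_nhds
  · simp [deriv_loc]
  · rw [hGeq]
    exact hsmooth.comp (contDiff_pi.2 fun k => (contDiff_apply ℝ ℝ k).div_const _)
  -- Every continuous version agrees with the explicit kernel at each `v > 0`, so the formula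
  -- `Φ_d(τ(w); Σ₀)` holds for an arbitrary `κ`.
  · have hF : ∀ v > 0, ∀ w : Fin d → ℝ, (∀ k, 0 < affinePoint (rhoZero P Y) k (w k) v) →
        normCondCDF κ (loc (rhoZero P Y)) (scale (rhoZero P Y)) v w =
          gaussCDF (sigmaZero P Y) fun k => residualPoint (rhoZero P Y) k (w k) v := by
      intro v hv w hw
      rw [← normCondCDF_residualKernel hρ (map_residual hY hS) hw, normCondCDF, normCondCDF,
        hκ.eq_of_pos (hexp 0) hker hv]
    refine ⟨eventually_contDiffAt hρ hsmooth hF z, fun l hl => ?_, fun k => ?_⟩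
    · rw [hGpartial]
      exact tendsto_iterPartial_of_nodup hρ hsmooth hF hl z
    · rw [hGpartial]
      exact tendsto_iterPartial_pair hρ hsmooth hF k z
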